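/- Let $\mathbb F\in\{\mathbb R,\mathbb C\}$ and let $M$ be a Hausdorff smooth manifold. Write $R=C_c^\infty(M)$ for the (possibly non-unital) ring of smooth $\mathbb F$-valued functions with compact support on $M$; for $f\in R$ let $f_x$ be its germ at $x\in M$. A *sheaf* on $M$ is a local diffeomorphism $\pi:E\to M$ from a not necessarily Hausdorff smooth manifold $E$; a morphism of sheaves is a smooth map over $M$. An open set $U\subset E$ is *$\pi$-elementary* if $\pi|_U$ is injective. $C_c^\infty(E)$ is the set of finite sums, in the space of all (not necessarily continuous) sections of the sheaf of germs of smooth functions on $E$, of extensions by zero of smooth functions with compact support on Hausdorff open subsets of $E$. It is an $R$-module by $(pu)_y=(p\circ\pi)_y\,u_y$. For $U$ $\pi$-elementary and $f\in C_c^\infty(\pi(U))$, the extension by zero of $f\circ\pi|_U$ is an element of $C_c^\infty(E)$, again written $f\circ\pi|_U$. A local diffeomorphism $\phi:E\to F$ induces $\phi_+:C_c^\infty(E)\to C_c^\infty(F)$, $\phi_+(u)_z=\sum_{\phi(y)=z}(\phi_y^*)^{-1}(u_y)$, where $\phi_y^*$ is the pull-back isomorphism of germs. An *$R$-coalgebra*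 is an $R$-module $C$ that is locally unitary (for any finitely many $c_i\in C$ there is $r\in R$ with $rc_i=c_i$ for all $i$), with $R$-linear maps $\Delta:C\to C\otimes_RC$ and $\epsilon:C\to R$ such that $(\mathrm{id}\otimes\epsilon)\Delta=\mathrm{id}=(\epsilon\otimes\mathrm{id})\Delta$; homomorphisms are the $R$-linear maps compatible with $\Delta$ and $\epsilon$. $C_c^\infty(E)$ is an $R$-coalgebra with $\Delta=\Omega^{-1}\circ\mathrm{diag}_+$ and $\epsilon=\pi_+$, where $\mathrm{diag}:E\to E\times_ME$ is the diagonal and $\Omega:C_c^\infty(E)\otimes_RC_c^\infty(E)\to C_c^\infty(E\times_ME)$ is the isomorphism $\Omega(u\otimes v)_{(y,z)}=\mathrm{pr}_1^*(u_y)\,\mathrm{pr}_2^*(v_z)$; with $\phi\mapsto\phi_+$ this gives a functor $C_c^\infty$ from sheaves on $M$ to $R$-coalgebras. For an $R$-coalgebra $C$ and $x\in M$ let $C_x=C/N_x(C)$, where $N_x(C)=\{c\in C: fc=0\text{ for some }f\in R\text{ with }f_x=1\}$, and let $c_x$ be the class of $c$. Then $C_x$ is, with the induced maps $\Delta_x,\epsilon_x$,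 a coalgebra over the ring $R_x$ of germs at $x$ of smooth functions; let $G(C_x)=\{\zeta\in C_x:\Delta_x(\zeta)=\zeta\otimes\zeta,\ \epsilon_x(\zeta)=1\}$. An element $c\in C$ is *weakly grouplike* if $\Delta(c)=c\otimes c'$ for some $c'\in C$. The *spectral sheaf* $\mathcal E_{sp}(C)$ is the sheaf on $M$ with stalk $G(C_x)$ at $x$, whose topology has as basis the sets $c_W=\{c_x: x\in W\}$ with $W\subset M$ open and $c\in C$ weakly grouplike with $\epsilon(c)_x=1$ for all $x\in W$, and whose smooth structure is the one that makes the projection to $M$ a local diffeomorphism. A homomorphism $\alpha:C\to D$ of coalgebras induces $\mathcal E_{sp}(\alpha)$, given by $c_x\mapsto\alpha(c)_x$ on the stalk at $x$; so $\mathcal E_{sp}$ is a functor from $R$-coalgebras to sheaves on $M$. **Theorem.** There is a natural isomorphism $\Phi:\mathrm{id}\to\mathcal E_{sp}\circ C_c^\infty$ of functors from sheaves on $M$ to sheaves on $M$ such that for every sheaf $\pi:E\to M$ and every $y\in E$ $$\Phi_E(y)=(f\circ\pi|_U)_{\pi(y)}\in G\bigl(C_c^\infty(E)_{\pi(y)}\bigr)$$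 for every $\pi$-elementary $U\subset E$ with $y\in U$ and every $f\in C_c^\infty(\pi(U))$ with $f_{\pi(y)}=1$; such $U$ and $f$ exist for every $y$. In particular $(f\circ\pi|_U)_{\pi(y)}$ does not depend on the choice of $U$ and $f$, and $\Phi_E:E\to\mathcal E_{sp}(C_c^\infty(E))$ is an isomorphism of sheaves on $M$, natural in $E$. -/

import Mathlib

open Filter Topology CategoryTheory
open scoped Manifold ContDiff TensorProduct

universe u


namespace SheafCoalg

noncomputable section

/-! ### Étale spaces over a manifold and their smooth structure -/

section Manifolds

variable {n : ℕ} {M : Type u} [TopologicalSpace M] [ChartedSpace (EuclideanSpace ℝ (Fin n)) M]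

/-- The charts on `X` obtained from those of `M` through a local homeomorphism `p : X → M`. -/
@[reducible] def pullbackCharts {X : Type u} [TopologicalSpace X] (p : X → M)
    (hp : IsLocalHomeomorph p) : ChartedSpace (EuclideanSpace ℝ (Fin n)) X where
  atlas := Set.range fun x => (hp x).choose.trans (chartAt (EuclideanSpace ℝ (Fin n)) (p x))
  chartAt x := (hp x).choose.trans (chartAt (EuclideanSpace ℝ (Fin n)) (p x))
  mem_chart_source x := by
    have h := (hp x).choose_spec
    simp only [OpenPartialHomeomorph.trans_source, Set.mem_inter_iff, Set.mem_preimage]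
    refine ⟨h.1, ?_⟩
    rw [← h.2]; exact mem_chart_source _ _
  chart_mem_atlas x := ⟨x, rfl⟩

theorem pullbackCharts_isManifold {X : Type u} [TopologicalSpace X] (p : X → M)
    (hp : IsLocalHomeomorph p) [IsManifold (𝓡 n) ∞ M] :
    @IsManifold ℝ _ _ _ _ _ _ (𝓡 n) ∞ X _ (pullbackCharts p hp) := by
  let := pullbackCharts (n := n) p hp
  refine { compatible := ?_ }
  rintro _ _ ⟨x, rfl⟩ ⟨y, rfl⟩
  set s₁ := (hp x).choose with hs₁
  set s₂ := (hp y).choose with hs₂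
  have h₁ : p = s₁ := (hp x).choose_spec.2
  have h₂ : p = s₂ := (hp y).choose_spec.2
  set c₁ := chartAt (EuclideanSpace ℝ (Fin n)) (p x)
  set c₂ := chartAt (EuclideanSpace ℝ (Fin n)) (p y)
  have hc : c₁.symm.trans c₂ ∈ contDiffGroupoid ∞ (𝓡 n) :=
    HasGroupoid.compatible (chart_mem_atlas _ _) (chart_mem_atlas _ _)
  set T := (s₁.trans c₁).symm.trans (s₂.trans c₂)
  have key : ∀ z ∈ T.source, c₁.symm z ∈ c₂.source ∧ z ∈ c₁.target ∧
      s₂ (s₁.symm (c₁.symm z)) = c₁.symm z := by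
    intro z hz
    simp only [T, mfld_simps] at hz
    have : s₂ (s₁.symm (c₁.symm z)) = c₁.symm z := by
      rw [← h₂, h₁, s₁.right_inv hz.1.2]
    exact ⟨this ▸ hz.2.2, hz.1.1, this⟩
  refine (contDiffGroupoid ∞ (𝓡 n)).mem_of_eqOnSource
    (closedUnderRestriction' hc T.open_source) ⟨?_, ?_⟩
  · rw [OpenPartialHomeomorph.restr_source, T.open_source.interior_eq]
    refine (Set.inter_eq_right.2 fun z hz => ?_).symm
    simp only [mfld_simps]
    exact ⟨(key z hz).2.1, (key z hz).1⟩
  · intro z hz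
    have := (key z hz).2.2
    simp [T, this]

/-- A map into the source of a local diffeomorphism is smooth if it is continuous and its
composite with the local diffeomorphism is smooth. -/
theorem contMDiffAt_of_comp {X Y : Type u} [TopologicalSpace X] [TopologicalSpace Y]
    [ChartedSpace (EuclideanSpace ℝ (Fin n)) X] [ChartedSpace (EuclideanSpace ℝ (Fin n)) Y]
    {p : X → M} (hp : IsLocalDiffeomorph (𝓡 n) (𝓡 n) ∞ p) {g : Y → X} {y : Y}
    (hg : ContinuousAt g y) (hpg : ContMDiffAt (𝓡 n) (𝓡 n) ∞ (p ∘ g) y) :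
    ContMDiffAt (𝓡 n) (𝓡 n) ∞ g y := by
  have h := hp (g y)
  have h1 : ContMDiffAt (𝓡 n) (𝓡 n) ∞ (h.localInverse ∘ (p ∘ g)) y :=
    ContMDiffAt.comp y h.localInverse_contMDiffAt hpg
  refine h1.congr_of_eventuallyEq ?_
  filter_upwards [hg.eventually h.localInverse_eventuallyEq_left] with z hz
  exact hz.symm

theorem pullbackCharts_isLocalDiffeomorph {X : Type u} [TopologicalSpace X] (p : X → M)
    (hp : IsLocalHomeomorph p) [IsManifold (𝓡 n) ∞ M] :
    @IsLocalDiffeomorph ℝ _ _ _ _ _ _ _ _ _ _ _ (𝓡 n) (𝓡 n) X _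
      (pullbackCharts p hp) M _ _ ∞ p := by
  let := pullbackCharts (n := n) p hp
  have := pullbackCharts_isManifold (n := n) p hp
  have hchart : ∀ x, chartAt (EuclideanSpace ℝ (Fin n)) x =
    (hp x).choose.trans (chartAt (EuclideanSpace ℝ (Fin n)) (p x)) := fun x => rfl
  have hsm : ContMDiff (𝓡 n) (𝓡 n) ∞ p := by
    intro x
    have hx := mem_chart_source (EuclideanSpace ℝ (Fin n)) x
    have h1 : ContMDiffAt (𝓡 n) (𝓡 n) ∞ (chartAt (EuclideanSpace ℝ (Fin n)) x) x :=
      contMDiffOn_chart.contMDiffAt ((chartAt (EuclideanSpace ℝ (Fin n)) x).open_source.mem_nhds hx)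
    have h2 : ContMDiffAt (𝓡 n) (𝓡 n) ∞ (chartAt (EuclideanSpace ℝ (Fin n)) (p x)).symm
        (chartAt (EuclideanSpace ℝ (Fin n)) x x) := by
      refine contMDiffOn_chart_symm.contMDiffAt ((chartAt (EuclideanSpace ℝ (Fin n)) (p x)).open_target.mem_nhds ?_)
      have := (chartAt (EuclideanSpace ℝ (Fin n)) x).map_source hx
      rw [hchart x] at this ⊢
      simp only [mfld_simps] at this
      exact this.1
    refine (ContMDiffAt.comp x h2 h1).congr_of_eventuallyEq ?_
    filter_upwards [(chartAt (EuclideanSpace ℝ (Fin n)) x).open_source.mem_nhds hx] with z hz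
    rw [hchart x] at hz
    simp only [mfld_simps] at hz
    simp only [hchart x, Function.comp_apply, OpenPartialHomeomorph.coe_trans]
    rw [OpenPartialHomeomorph.left_inv _ hz.2]
    exact congrFun (hp x).choose_spec.2 z
  have hinv : ∀ x : X, ContMDiffAt (𝓡 n) (𝓡 n) ∞ (hp x).choose.symm (p x) := by
    intro x
    have hx := mem_chart_source (EuclideanSpace ℝ (Fin n)) x
    have hpx := mem_chart_source (EuclideanSpace ℝ (Fin n)) (p x)
    have h1 : ContMDiffAt (𝓡 n) (𝓡 n) ∞ (chartAt (EuclideanSpace ℝ (Fin n)) (p x)) (p x) :=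
      contMDiffOn_chart.contMDiffAt
        ((chartAt (EuclideanSpace ℝ (Fin n)) (p x)).open_source.mem_nhds hpx)
    have hcx : chartAt (EuclideanSpace ℝ (Fin n)) x x =
        chartAt (EuclideanSpace ℝ (Fin n)) (p x) (p x) := by
      rw [hchart x]; simp [← (hp x).choose_spec.2]
    have h2 : ContMDiffAt (𝓡 n) (𝓡 n) ∞ (chartAt (EuclideanSpace ℝ (Fin n)) x).symm
        (chartAt (EuclideanSpace ℝ (Fin n)) (p x) (p x)) := by
      rw [← hcx]
      exact contMDiffOn_chart_symm.contMDiffAt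
        ((chartAt (EuclideanSpace ℝ (Fin n)) x).open_target.mem_nhds
          ((chartAt (EuclideanSpace ℝ (Fin n)) x).map_source hx))
    refine (ContMDiffAt.comp (p x) h2 h1).congr_of_eventuallyEq ?_
    filter_upwards [(chartAt (EuclideanSpace ℝ (Fin n)) (p x)).open_source.mem_nhds hpx] with z hz
    simp only [hchart x, Function.comp_apply, OpenPartialHomeomorph.coe_trans_symm]
    rw [OpenPartialHomeomorph.left_inv _ hz]
  intro x
  refine ⟨{ toPartialEquiv := (hp x).choose.toPartialEquiv
            open_source := (hp x).choose.open_source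
            open_target := (hp x).choose.open_target
            contMDiffOn_toFun := ?_
            contMDiffOn_invFun := ?_ }, (hp x).choose_spec.1, fun z _ => ?_⟩
  · have : ((hp x).choose.toPartialEquiv : X → M) = p := (hp x).choose_spec.2.symm
    rw [this]; exact hsm.contMDiffOn
  · intro z hz
    refine ContMDiffAt.contMDiffWithinAt ?_
    set s := (hp x).choose
    have hs : p = s := (hp x).choose_spec.2
    change ContMDiffAt (𝓡 n) (𝓡 n) ∞ s.symm z
    have hz' : z ∈ s.target := hz
    set x' := s.symm z
    have hpx' : p x' = z := by rw [hs]; exact s.right_inv hz'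
    have h3 := hinv x'
    rw [hpx'] at h3
    refine h3.congr_of_eventuallyEq ?_
    have hc : ContinuousAt s.symm z := s.symm.continuousAt hz'
    filter_upwards [s.open_target.mem_nhds hz', hc.eventually
      ((hp x').choose.open_source.mem_nhds (hp x').choose_spec.1)] with w hw hw'
    have e1 : p (s.symm w) = w := by rw [hs]; exact s.right_inv hw
    have e2 := (hp x').choose.left_inv hw'
    rw [← (hp x').choose_spec.2, e1] at e2
    exact e2.symm
  · exact congrFun (hp x).choose_spec.2 z

variable (n M) in
/-- A sheaf (of sets) on the manifold `M`, as an étale space: a local diffeomorphism from a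
manifold, which need not be Hausdorff, to `M`. -/
structure Shf [IsManifold (𝓡 n) ∞ M] where
  /-- the total space -/
  carrier : Type u
  [top : TopologicalSpace carrier]
  [charts : ChartedSpace (EuclideanSpace ℝ (Fin n)) carrier]
  [mfd : IsManifold (𝓡 n) ∞ carrier]
  /-- the projection -/
  proj : carrier → M
  isLocalDiffeo : IsLocalDiffeomorph (𝓡 n) (𝓡 n) ∞ proj

attribute [instance] Shf.top Shf.charts Shf.mfd

variable [IsManifold (𝓡 n) ∞ M]

instance : CoeSort (Shf n M) (Type u) := ⟨Shf.carrier⟩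

theorem Shf.homeo (E : Shf n M) : IsLocalHomeomorph E.proj :=
  E.isLocalDiffeo.isLocalHomeomorph

/-- A morphism of sheaves on `M`: a smooth map over `M`. -/
structure Shf.Hom (E F : Shf n M) where
  toFun : E → F
  smooth : ContMDiff (𝓡 n) (𝓡 n) ∞ toFun
  proj_comp : ∀ y, F.proj (toFun y) = E.proj y

theorem Shf.Hom.ext' {E F : Shf n M} {φ ψ : Shf.Hom E F} (h : ∀ y, φ.toFun y = ψ.toFun y) :
    φ = ψ := by
  cases φ; cases ψ; congr; exact funext h

instance : Category (Shf n M) where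
  Hom := Shf.Hom
  id E := ⟨id, contMDiff_id, fun _ => rfl⟩
  comp φ ψ := ⟨ψ.toFun ∘ φ.toFun, ψ.smooth.comp φ.smooth,
    fun y => (ψ.proj_comp _).trans (φ.proj_comp y)⟩

/-- A continuous map over `M` is a morphism of sheaves. -/
def Shf.homMk {E F : Shf n M} (φ : E → F) (hφ : Continuous φ)
    (h : ∀ y, F.proj (φ y) = E.proj y) : E ⟶ F where
  toFun := φ
  proj_comp := h
  smooth y := contMDiffAt_of_comp F.isLocalDiffeo hφ.continuousAt <| by
    have : F.proj ∘ φ = E.proj := funext h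
    rw [this]; exact E.isLocalDiffeo.contMDiff y

theorem Shf.Hom.homeo {E F : Shf n M} (φ : E ⟶ F) : IsLocalHomeomorph φ.toFun := by
  refine IsLocalHomeomorph.of_comp (g := F.proj) ?_ F.homeo φ.smooth.continuous
  have : F.proj ∘ φ.toFun = E.proj := funext φ.proj_comp
  rw [this]; exact E.homeo

/-- A topological étale space over `M`, with the unique smooth structure for which the
projection is a local diffeomorphism. -/
def Shf.ofLocalHomeo {X : Type u} [TopologicalSpace X] (p : X → M) (hp : IsLocalHomeomorph p) :
    Shf n M :=
  letI := pullbackCharts (n := n) p hp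
  haveI := pullbackCharts_isManifold (n := n) p hp
  { carrier := X
    proj := p
    isLocalDiffeo := pullbackCharts_isLocalDiffeomorph p hp }

variable (n M) in
/-- The sheaf `id : M → M`. -/
def Shf.base : Shf n M where
  carrier := M
  proj := id
  isLocalDiffeo := (Diffeomorph.refl (𝓡 n) M ∞).isLocalDiffeomorph

/-- The projection of `E`, as a morphism of sheaves to `id : M → M`. -/
def Shf.projHom (E : Shf n M) : E ⟶ Shf.base n M :=
  ⟨E.proj, E.isLocalDiffeo.contMDiff, fun _ => rfl⟩

theorem fiberProd_homeo (E F : Shf n M) : IsLocalHomeomorph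
    (fun p : {p : E × F // E.proj p.1 = F.proj p.2} => E.proj p.1.1) := by
  refine E.homeo.comp (g := E.proj) (f := fun p : {p : E × F // E.proj p.1 = F.proj p.2} => p.1.1) ?_
  refine IsLocalHomeomorph.mk _ fun p => ?_
  obtain ⟨⟨y, z⟩, hp⟩ := p
  set s := (F.homeo z).choose with hs
  have h1 := (F.homeo z).choose_spec.1
  have h2 : F.proj = s := (F.homeo z).choose_spec.2
  have hc : Continuous fun p : {p : E × F // E.proj p.1 = F.proj p.2} => p.1.2 :=
    continuous_snd.comp continuous_subtype_val
  have hr : ∀ w, E.proj w ∈ s.target → E.proj w = F.proj (s.symm (E.proj w)) := fun w hw => by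
    rw [h2, s.right_inv hw]
  classical
  refine ⟨{
    toFun := fun p => p.1.1
    invFun := fun w => if h : E.proj w ∈ s.target then ⟨(w, s.symm (E.proj w)), hr w h⟩
      else ⟨(y, z), hp⟩
    source := {p | p.1.2 ∈ s.source}
    target := E.proj ⁻¹' s.target
    map_source' := ?_
    map_target' := ?_
    left_inv' := ?_
    right_inv' := ?_
    open_source := s.open_source.preimage hc
    open_target := s.open_target.preimage E.homeo.continuous
    continuousOn_toFun := (continuous_fst.comp continuous_subtype_val).continuousOn
    continuousOn_invFun := ?_ }, h1, fun p _ => rfl⟩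
  · rintro ⟨⟨a, b⟩, hab⟩ h
    change E.proj a ∈ s.target
    change E.proj a = F.proj b at hab
    rw [hab, h2]; exact s.map_source h
  · intro w hw
    have hw' : E.proj w ∈ s.target := hw
    simp only [hw', dif_pos, Set.mem_ofPred_eq]
    exact s.map_target hw'
  · rintro ⟨⟨a, b⟩, hab⟩ h
    change E.proj a = F.proj b at hab
    change b ∈ s.source at h
    have hw' : E.proj a ∈ s.target := by rw [hab, h2]; exact s.map_source h
    simp only [hw', dif_pos, Subtype.mk.injEq, Prod.mk.injEq, true_and]
    rw [hab, h2]; exact s.left_inv h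
  · intro w hw
    have hw' : E.proj w ∈ s.target := hw
    simp only [hw', dif_pos]
  · have hi : IsInducing (Subtype.val : {p : E × F // E.proj p.1 = F.proj p.2} → E × F) := ⟨rfl⟩
    rw [hi.continuousOn_iff]
    have : ContinuousOn (fun w => (w, s.symm (E.proj w))) (E.proj ⁻¹' s.target) :=
      continuousOn_id.prodMk
        (s.continuousOn_symm.comp E.homeo.continuous.continuousOn fun _ h => h)
    refine this.congr fun w hw => ?_
    have hw' : E.proj w ∈ s.target := hw
    simp only [Function.comp_apply, hw', dif_pos]

/-- The fibred product `E ×_M F`. -/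
def Shf.fiberProd (E F : Shf n M) : Shf n M :=
  Shf.ofLocalHomeo _ (fiberProd_homeo E F)

/-- The diagonal `E → E ×_M E`. -/
def Shf.diag (E : Shf n M) : E ⟶ E.fiberProd E :=
  Shf.homMk (F := E.fiberProd E) (fun y => ⟨(y, y), rfl⟩)
    (Continuous.subtype_mk (continuous_id.prodMk continuous_id) _) fun _ => rfl

/-- An open subset of `E` on which the projection is injective. -/
def Shf.Elementary (E : Shf n M) (U : Set E) : Prop :=
  IsOpen U ∧ Set.InjOn E.proj U

end Manifolds

/-! ### Modules and coalgebras over a commutative ring that need not have an identity -/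

section Modules

/-- The ring obtained from `R` by adjoining an identity. A module over the non-unital ring `R` is
the same as a unital module over this ring, and tensor products over `R` are the same as tensor
products over this ring. -/
def Uz (R : Type u) [NonUnitalCommRing R] : Type u := Unitization ℤ R

variable {R : Type u} [NonUnitalCommRing R]

instance : CommRing (Uz R) := inferInstanceAs (CommRing (Unitization ℤ R))

/-- The inclusion of `R` into the ring obtained by adjoining an identity. -/
def Uz.of : R →ₙ+* Uz R where
  toFun r := (Unitization.inr r : Unitization ℤ R)
  map_mul' r s := Unitization.inr_mul ℤ r s
  map_zero' := Unitization.inr_zero ℤ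
  map_add' r s := Unitization.inr_add ℤ r s

/-- The extension of a homomorphism from `R` to a unital ring. -/
def Uz.lift {S : Type*} [Ring S] (φ : R →ₙ+* S) : Uz R →+* S :=
  (Unitization.lift ({ φ with map_smul' := fun m r => map_zsmul φ m r } : R →ₙₐ[ℤ] S)).toRingHom

@[simp] theorem Uz.lift_of {S : Type*} [Ring S] (φ : R →ₙ+* S) (r : R) :
    Uz.lift φ (Uz.of r) = φ r := by
  change (Unitization.lift ({ φ with map_smul' := fun m r => map_zsmul φ m r } : R →ₙₐ[ℤ] S))
    (Unitization.inr r) = _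
  simp

theorem Uz.induction {p : Uz R → Prop} (a : Uz R) (h1 : ∀ m : ℤ, p m)
    (h2 : ∀ r, p (Uz.of r)) (h3 : ∀ a b, p a → p b → p (a + b)) : p a := by
  refine Unitization.ind (fun m r => ?_) a
  refine h3 _ _ ?_ (h2 r)
  have : (Unitization.inl m : Unitization ℤ R) = (m : Uz R) := by
    exact (map_intCast (Unitization.inlRingHom ℤ R) m)
  rw [this]; exact h1 m

/-- The action of `r : R` on an element of an `R`-module. -/
def act {C : Type*} [AddCommGroup C] [Module (Uz R) C] (r : R) (c : C) : C :=
  Uz.of r • c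

section act

variable {C D : Type*} [AddCommGroup C] [Module (Uz R) C] [AddCommGroup D] [Module (Uz R) D]
  (r s : R) (c d : C) (a : Uz R)

theorem act_mul : act (r * s) c = act r (act s c) := by
  simp only [act, map_mul, mul_smul]

@[simp] theorem act_zero : act r (0 : C) = 0 := smul_zero _
theorem act_add : act r (c + d) = act r c + act r d := smul_add _ _ _
theorem act_sub : act r (c - d) = act r c - act r d := smul_sub _ _ _
theorem add_act : act (r + s) c = act r c + act s c := by simp only [act, map_add, add_smul]
theorem act_smul : act r (a • c) = a • act r c := smul_comm _ _ _
theorem map_act (α : C →ₗ[Uz R] D) : α (act r c) = act r (α c) := map_smul _ _ _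

theorem act_tmul (e : D) : act r (c ⊗ₜ[Uz R] e) = act r c ⊗ₜ e := TensorProduct.smul_tmul' _ _ _

theorem act_tmul' (e : D) : act r (c ⊗ₜ[Uz R] e) = c ⊗ₜ act r e :=
  (TensorProduct.tmul_smul _ _ _).symm

end act

/-- `R` as a module over itself. -/
instance selfModule : Module (Uz R) R :=
  Module.compHom R (Uz.lift (S := Module.End ℤ R)
    { toFun := fun r => LinearMap.mulLeft ℤ r
      map_mul' := fun r s => by ext t; simp
      map_zero' := by ext t; simp
      map_add' := fun r s => by ext t; simp [add_mul] })

theorem selfModule_act (r s : R) : act r s = r * s := by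
  change (Uz.lift (S := Module.End ℤ R) _ (Uz.of r)) s = _
  rw [Uz.lift_of]; rfl

theorem Uz.of_smul (a : Uz R) (r : R) : Uz.of (a • r) = a * Uz.of r := by
  induction a using Uz.induction with
  | h1 m => rw [Int.cast_smul_eq_zsmul, map_zsmul, zsmul_eq_mul]
  | h2 s => rw [← map_mul, ← selfModule_act]; rfl
  | h3 a b ha hb => rw [add_smul, map_add, ha, hb, add_mul]

variable (R) in
/-- The bilinear action map `c, r ↦ r c`. -/
def actHom (C : Type*) [AddCommGroup C] [Module (Uz R) C] : C →ₗ[Uz R] R →ₗ[Uz R] C :=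
  LinearMap.mk₂ (Uz R) (fun c r => act r c) (fun _ _ _ => smul_add _ _ _)
    (fun a c r => smul_comm _ _ _)
    (fun c r s => add_act _ _ _)
    (fun a c r => by rw [act, Uz.of_smul, mul_smul]; rfl)

/-- `id ⊗ ε`, with `C ⊗ R` identified with `C`. -/
def idTensor {C : Type*} [AddCommGroup C] [Module (Uz R) C] (ε : C →ₗ[Uz R] R) :
    C ⊗[Uz R] C →ₗ[Uz R] C :=
  TensorProduct.lift (actHom R C) ∘ₗ TensorProduct.map LinearMap.id ε

/-- `ε ⊗ id`, with `R ⊗ C` identified with `C`. -/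
def tensorId {C : Type*} [AddCommGroup C] [Module (Uz R) C] (ε : C →ₗ[Uz R] R) :
    C ⊗[Uz R] C →ₗ[Uz R] C :=
  TensorProduct.lift (actHom R C).flip ∘ₗ TensorProduct.map ε LinearMap.id

@[simp] theorem idTensor_tmul {C : Type*} [AddCommGroup C] [Module (Uz R) C] (ε : C →ₗ[Uz R] R)
    (c d : C) : idTensor ε (c ⊗ₜ d) = act (ε d) c := rfl

@[simp] theorem tensorId_tmul {C : Type*} [AddCommGroup C] [Module (Uz R) C] (ε : C →ₗ[Uz R] R)
    (c d : C) : tensorId ε (c ⊗ₜ d) = act (ε c) d := rfl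

variable (R) in
/-- A coalgebra over `R`: a locally unitary `R`-module with a comultiplication and a counit. -/
structure Coalg where
  carrier : Type u
  [addCommGroup : AddCommGroup carrier]
  [module : Module (Uz R) carrier]
  locallyUnitary : ∀ s : Finset carrier, ∃ r : R, ∀ c ∈ s, act r c = c
  comul : carrier →ₗ[Uz R] carrier ⊗[Uz R] carrier
  counit : carrier →ₗ[Uz R] R
  id_counit : ∀ c, idTensor counit (comul c) = c
  counit_id : ∀ c, tensorId counit (comul c) = c

attribute [instance] Coalg.addCommGroup Coalg.module

instance : CoeSort (Coalg R) (Type u) := ⟨Coalg.carrier⟩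

/-- A homomorphism of coalgebras. -/
structure Coalg.Hom (C D : Coalg R) where
  lin : C →ₗ[Uz R] D
  comul_comp : ∀ c, TensorProduct.map lin lin (C.comul c) = D.comul (lin c)
  counit_comp : ∀ c, D.counit (lin c) = C.counit c

theorem Coalg.Hom.ext' {C D : Coalg R} {α β : Coalg.Hom C D} (h : ∀ c, α.lin c = β.lin c) :
    α = β := by
  cases α; cases β; congr; exact LinearMap.ext h

instance : Category (Coalg R) where
  Hom := Coalg.Hom
  id C := ⟨LinearMap.id, fun c => by simp, fun _ => rfl⟩
  comp α β := ⟨β.lin ∘ₗ α.lin,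
    fun c => by rw [TensorProduct.map_comp, LinearMap.comp_apply, α.comul_comp, β.comul_comp]; rfl,
    fun c => (β.counit_comp _).trans (α.counit_comp c)⟩

/-- The weakly grouplike elements: `Δ(c) = c ⊗ c'` for some `c'`. -/
def Coalg.WeaklyGrouplike (C : Coalg R) (c : C) : Prop :=
  ∃ c' : C, C.comul c = c ⊗ₜ c'

end Modules

/-! ### The ring of smooth functions with compact support on a Hausdorff manifold -/

section Base

variable (𝕜 : Type) [RCLike 𝕜] (n : ℕ) (M : Type u) [TopologicalSpace M]
  [ChartedSpace (EuclideanSpace ℝ (Fin n)) M]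

/-- The non-unital ring of smooth `𝕜`-valued functions with compact support on `M`. -/
def smoothCompact : NonUnitalSubring (M → 𝕜) where
  carrier := {f | ContMDiff (𝓡 n) 𝓘(ℝ, 𝕜) ∞ f ∧ HasCompactSupport f}
  zero_mem' := ⟨contMDiff_const, HasCompactSupport.zero⟩
  add_mem' hf hg := ⟨hf.1.add hg.1, hf.2.add hg.2⟩
  neg_mem' hf := ⟨hf.1.neg, hf.2.neg⟩
  mul_mem' hf hg := ⟨contDiff_mul.contMDiff.comp (hf.1.prodMk_space hg.1), hf.2.mul_right⟩

/-- `C_c^∞(M)`. -/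
def Rc : Type u := smoothCompact 𝕜 n M

instance : NonUnitalCommRing (Rc 𝕜 n M) := inferInstanceAs (NonUnitalCommRing (smoothCompact 𝕜 n M))

instance : CoeFun (Rc 𝕜 n M) (fun _ => M → 𝕜) := ⟨fun f => f.1⟩

variable {𝕜 n M} in
theorem Rc.ext {f g : Rc 𝕜 n M} (h : ∀ x, f x = g x) : f = g := Subtype.ext (funext h)

section

variable {𝕜 n M} (f g : Rc 𝕜 n M) (x : M)

@[simp] theorem Rc.add_apply : (f + g) x = f x + g x := rfl
@[simp] theorem Rc.sub_apply : (f - g) x = f x - g x := rfl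
@[simp] theorem Rc.neg_apply : (-f) x = -f x := rfl
@[simp] theorem Rc.mul_apply : (f * g) x = f x * g x := rfl
@[simp] theorem Rc.zero_apply : (0 : Rc 𝕜 n M) x = 0 := rfl

end


variable {𝕜 n M}

/-- `f` equals `1` on a neighbourhood of `x`, i.e. its germ at `x` is `1`. -/
def OneAt (f : Rc 𝕜 n M) (x : M) : Prop := f.1 =ᶠ[𝓝 x] 1

theorem OneAt.mul {f g : Rc 𝕜 n M} {x : M} (hf : OneAt f x) (hg : OneAt g x) :
    OneAt (f * g) x := by
  filter_upwards [hf, hg] with y h1 h2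
  simp [h1, h2]

theorem exists_bump [T2Space M] [IsManifold (𝓡 n) ∞ M] (x : M) {W : Set M} (hW : W ∈ 𝓝 x) :
    ∃ b : Rc 𝕜 n M, OneAt b x ∧ tsupport b.1 ⊆ W := by
  obtain ⟨f, -, hf⟩ := (SmoothBumpFunction.nhds_basis_tsupport (I := 𝓡 n) x).mem_iff.1 hW
  have hs : tsupport (fun y => (RCLike.ofReal (f y) : 𝕜)) ⊆ tsupport f := by
    refine closure_mono fun y hy => ?_
    simpa using hy
  refine ⟨⟨fun y => (RCLike.ofReal (f y) : 𝕜), ?_, ?_⟩, ?_, hs.trans hf⟩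
  · exact (RCLike.ofRealCLM (K := 𝕜)).contDiff.contMDiff.comp f.contMDiff
  · exact f.hasCompactSupport.mono (by intro y hy; simpa using hy)
  · filter_upwards [f.eventuallyEq_one] with y hy
    simp [hy]

theorem exists_one_on_compact [T2Space M] [IsManifold (𝓡 n) ∞ M] {K O : Set M} (hK : IsCompact K)
    (hO : IsOpen O) (hKO : K ⊆ O) :
    ∃ r : Rc 𝕜 n M, (∀ x ∈ K, OneAt r x) ∧ tsupport r.1 ⊆ O := by
  refine hK.induction_on (p := fun K => ∃ r : Rc 𝕜 n M, (∀ x ∈ K, OneAt r x) ∧ tsupport r.1 ⊆ O)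
    ⟨0, by simp, by simp [tsupport, show (0 : Rc 𝕜 n M).1 = 0 from rfl]⟩
    (fun s t hst h => h.imp fun r hr => ⟨fun x hx => hr.1 x (hst hx), hr.2⟩) ?_ ?_
  · rintro s t ⟨r, hr, hr'⟩ ⟨q, hq, hq'⟩
    refine ⟨r + q - r * q, ?_, ?_⟩
    · rintro x (hx | hx)
      · filter_upwards [hr x hx] with y hy
        simp [hy]
      · filter_upwards [hq x hx] with y hy
        simp [hy]
    · refine subset_trans (closure_minimal (t := tsupport r.1 ∪ tsupport q.1) (fun y hy => ?_)
        ((isClosed_tsupport _).union (isClosed_tsupport _))) (Set.union_subset hr' hq')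
      by_contra h
      rw [Set.mem_union, not_or] at h
      have h1 : r y = 0 := image_eq_zero_of_notMem_tsupport h.1
      have h2 : q y = 0 := image_eq_zero_of_notMem_tsupport h.2
      exact hy (by change r y + q y - r y * q y = 0; simp [h1, h2])
  · intro x hx
    obtain ⟨b, hb, hb'⟩ := exists_bump (𝕜 := 𝕜) (n := n) x (hO.mem_nhds (hKO hx))
    exact ⟨_, mem_nhdsWithin_of_mem_nhds (eventually_eventually_nhds.2 hb), b, fun y hy => hy, hb'⟩

/-! ### Localization of modules and coalgebras at a point -/

variable [T2Space M] [IsManifold (𝓡 n) ∞ M]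

variable (𝕜 n) in
/-- `N_x(C)`: the elements annihilated by a function which equals `1` near `x`. -/
def nullAt (x : M) (C : Type*) [AddCommGroup C] [Module (Uz (Rc 𝕜 n M)) C] :
    Submodule (Uz (Rc 𝕜 n M)) C where
  carrier := {c | ∃ f : Rc 𝕜 n M, OneAt f x ∧ act f c = 0}
  zero_mem' := (exists_bump x univ_mem).imp fun f hf => ⟨hf.1, act_zero _⟩
  add_mem' := by
    rintro c d ⟨f, hf, hc⟩ ⟨g, hg, hd⟩
    refine ⟨f * g, hf.mul hg, ?_⟩
    rw [act_add, mul_comm, act_mul, hc, mul_comm, act_mul, hd]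
    simp
  smul_mem' := by
    rintro a c ⟨f, hf, hc⟩
    exact ⟨f, hf, by rw [act_smul, hc, smul_zero]⟩

variable (𝕜 n) in
/-- `C_x = C / N_x(C)`. -/
abbrev Loc (x : M) (C : Type*) [AddCommGroup C] [Module (Uz (Rc 𝕜 n M)) C] :=
  C ⧸ nullAt 𝕜 n x C

variable (𝕜 n) in
/-- The class `c_x` of `c` in `C_x`. -/
abbrev Loc.mk (x : M) {C : Type*} [AddCommGroup C] [Module (Uz (Rc 𝕜 n M)) C] (c : C) : Loc 𝕜 n x C :=
  (nullAt 𝕜 n x C).mkQ c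

theorem Loc.act_eq {x : M} {C : Type*} [AddCommGroup C] [Module (Uz (Rc 𝕜 n M)) C]
    {f : Rc 𝕜 n M} (hf : OneAt f x) (c : C) : Loc.mk 𝕜 n x (act f c) = Loc.mk 𝕜 n x c := by
  obtain ⟨g, hg, hgs⟩ := exists_bump (𝕜 := 𝕜) (n := n) x (eventually_eventually_nhds.2 hf)
  refine (Submodule.Quotient.eq _).2 ⟨g, hg, ?_⟩
  have : g * f = g := by
    refine Rc.ext fun y => ?_
    by_cases hy : g y = 0
    · simp [hy]
    · have : y ∈ tsupport g.1 := subset_tsupport _ hy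
      have := (hgs this).self_of_nhds
      simp [this]
  rw [act_sub, ← act_mul, this, sub_self]

/-- The map `α_x : C_x → D_x` induced by a linear map. -/
def Loc.map (x : M) {C D : Type*} [AddCommGroup C] [Module (Uz (Rc 𝕜 n M)) C]
    [AddCommGroup D] [Module (Uz (Rc 𝕜 n M)) D] (α : C →ₗ[Uz (Rc 𝕜 n M)] D) :
    Loc 𝕜 n x C →ₗ[Uz (Rc 𝕜 n M)] Loc 𝕜 n x D :=
  Submodule.mapQ _ _ α <| by
    rintro c ⟨f, hf, hc⟩
    exact ⟨f, hf, by rw [← map_act, hc, map_zero]⟩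

variable (𝕜 n) in
/-- The canonical surjection `C ⊗ C → C_x ⊗ C_x`. -/
abbrev Loc.tensor (x : M) (C : Type*) [AddCommGroup C] [Module (Uz (Rc 𝕜 n M)) C] :
    C ⊗[Uz (Rc 𝕜 n M)] C →ₗ[Uz (Rc 𝕜 n M)] Loc 𝕜 n x C ⊗[Uz (Rc 𝕜 n M)] Loc 𝕜 n x C :=
  TensorProduct.map (nullAt 𝕜 n x C).mkQ (nullAt 𝕜 n x C).mkQ

/-- The kernel of `C ⊗ C → C_x ⊗ C_x` is `N_x(C ⊗ C)`. -/
theorem Loc.tensor_eq_zero_iff {x : M} {C : Type*} [AddCommGroup C] [Module (Uz (Rc 𝕜 n M)) C]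
    (t : C ⊗[Uz (Rc 𝕜 n M)] C) :
    Loc.tensor 𝕜 n x C t = 0 ↔ t ∈ nullAt 𝕜 n x (C ⊗[Uz (Rc 𝕜 n M)] C) := by
  constructor
  · intro h
    let B : C →ₗ[Uz (Rc 𝕜 n M)] C →ₗ[Uz (Rc 𝕜 n M)] Loc 𝕜 n x (C ⊗[Uz (Rc 𝕜 n M)] C) :=
      (TensorProduct.mk (Uz (Rc 𝕜 n M)) C C).compr₂ (nullAt 𝕜 n x _).mkQ
    have h1 : nullAt 𝕜 n x C ≤ LinearMap.ker B := by
      rintro c ⟨f, hf, hc⟩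
      refine LinearMap.ext fun d => (Submodule.Quotient.mk_eq_zero _).2 ⟨f, hf, ?_⟩
      change act f (c ⊗ₜ d) = 0
      rw [act_tmul, hc, TensorProduct.zero_tmul]
    have h2 : nullAt 𝕜 n x C ≤ LinearMap.ker B.flip := by
      rintro c ⟨f, hf, hc⟩
      refine LinearMap.ext fun d => (Submodule.Quotient.mk_eq_zero _).2 ⟨f, hf, ?_⟩
      change act f (d ⊗ₜ c) = 0
      rw [act_tmul', hc, TensorProduct.tmul_zero]
    have h3 : (TensorProduct.lift (B.liftQ₂ (nullAt 𝕜 n x C) (nullAt 𝕜 n x C) h1 h2)) ∘ₗ Loc.tensor 𝕜 n x C =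
        (nullAt 𝕜 n x (C ⊗[Uz (Rc 𝕜 n M)] C)).mkQ := by
      refine TensorProduct.ext' fun c d => ?_
      rfl
    have h4 := LinearMap.congr_fun h3 t
    rw [LinearMap.comp_apply, h, map_zero] at h4
    exact (Submodule.Quotient.mk_eq_zero _).1 h4.symm
  · rintro ⟨f, hf, ht⟩
    have h : ∀ t : C ⊗[Uz (Rc 𝕜 n M)] C, Loc.tensor 𝕜 n x C (act f t) = Loc.tensor 𝕜 n x C t := by
      intro t
      induction t using TensorProduct.induction_on with
      | zero => simp
      | tmul c d =>
        rw [act_tmul, TensorProduct.map_tmul, TensorProduct.map_tmul]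
        exact congrArg (fun e => e ⊗ₜ _) (Loc.act_eq hf c)
      | add s t hs ht =>
        rw [act_add, map_add, map_add]; exact congrArg₂ _ hs ht
    rw [← h, ht, map_zero]

variable (C : Coalg (Rc 𝕜 n M)) (x : M)

/-- The comultiplication `Δ_x : C_x → C_x ⊗ C_x` induced by `Δ`. The tensor product over
`C_c^∞(M)` of two modules over the ring of germs at `x` is their tensor product over that ring,
because `C_c^∞(M)` maps onto it. -/
def Coalg.comulAt : Loc 𝕜 n x C →ₗ[Uz (Rc 𝕜 n M)] Loc 𝕜 n x C ⊗[Uz (Rc 𝕜 n M)] Loc 𝕜 n x C :=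
  (nullAt 𝕜 n x C).liftQ (Loc.tensor 𝕜 n x C ∘ₗ C.comul) <| by
    rintro c ⟨f, hf, hc⟩
    refine (Loc.tensor_eq_zero_iff _).2 ⟨f, hf, ?_⟩
    rw [← map_act, hc, map_zero]

/-- The counit `ε_x : C_x → (C^∞_M)_x` induced by `ε`. -/
def Coalg.counitAt : Loc 𝕜 n x C →+ Germ (𝓝 x) 𝕜 :=
  QuotientAddGroup.lift (nullAt 𝕜 n x C).toAddSubgroup
    ((Germ.coeAddHom (𝓝 x)).comp
      ((smoothCompact 𝕜 n M).toAddSubgroup.subtype.comp C.counit.toAddMonoidHom)) <| by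
    rintro c ⟨f, hf, hc⟩
    have h : f * C.counit c = 0 := by
      rw [← selfModule_act, ← map_act, hc, map_zero]
    refine (Germ.coe_eq (f := (C.counit c).1) (g := 0)).2 ?_
    filter_upwards [hf] with y hy
    have := congrArg (fun r : Rc 𝕜 n M => r y) h
    simpa [hy] using this

/-- The grouplike elements of `C_x`. -/
def Coalg.Grouplike (ζ : Loc 𝕜 n x C) : Prop :=
  C.comulAt x ζ = ζ ⊗ₜ ζ ∧ C.counitAt x ζ = 1

end Base

/-! ### The spectral sheaf of a coalgebra -/

section Spectral

variable {𝕜 : Type} [RCLike 𝕜] {n : ℕ} {M : Type u} [TopologicalSpace M]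
  [ChartedSpace (EuclideanSpace ℝ (Fin n)) M] [T2Space M] [IsManifold (𝓡 n) ∞ M]

theorem Coalg.comulAt_mk (C : Coalg (Rc 𝕜 n M)) (x : M) (c : C) :
    C.comulAt x (Loc.mk 𝕜 n x c) = Loc.tensor 𝕜 n x C (C.comul c) := rfl

theorem Coalg.counitAt_mk (C : Coalg (Rc 𝕜 n M)) (x : M) (c : C) :
    C.counitAt x (Loc.mk 𝕜 n x c) = ((C.counit c).1 : Germ (𝓝 x) 𝕜) := rfl

theorem Coalg.counitAt_mk_eq_one (C : Coalg (Rc 𝕜 n M)) (x : M) (c : C) :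
    C.counitAt x (Loc.mk 𝕜 n x c) = 1 ↔ OneAt (C.counit c) x :=
  Germ.coe_eq (f := (C.counit c).1) (g := 1)

theorem Coalg.WeaklyGrouplike.grouplike {C : Coalg (Rc 𝕜 n M)} {c : C} (hc : C.WeaklyGrouplike c)
    {x : M} (hx : OneAt (C.counit c) x) : C.Grouplike x (Loc.mk 𝕜 n x c) := by
  obtain ⟨c', h⟩ := hc
  refine ⟨?_, (C.counitAt_mk_eq_one x c).2 hx⟩
  have h1 : act (C.counit c) c' = c := by
    have := C.counit_id c
    rwa [h, tensorId_tmul] at this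
  have h2 : Loc.mk 𝕜 n x c' = Loc.mk 𝕜 n x c := by
    rw [← Loc.act_eq hx, h1]
  rw [C.comulAt_mk, h, TensorProduct.map_tmul]
  exact congrArg _ h2

theorem Coalg.Grouplike.exists_rep {C : Coalg (Rc 𝕜 n M)} {x : M} {ζ : Loc 𝕜 n x C}
    (hζ : C.Grouplike x ζ) :
    ∃ c : C, C.WeaklyGrouplike c ∧ OneAt (C.counit c) x ∧ ζ = Loc.mk 𝕜 n x c := by
  obtain ⟨c, rfl⟩ := Submodule.mkQ_surjective _ ζ
  have h1 := (C.counitAt_mk_eq_one x c).1 hζ.2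
  have h2 : Loc.tensor 𝕜 n x C (C.comul c - c ⊗ₜ c) = 0 := by
    rw [map_sub, TensorProduct.map_tmul, sub_eq_zero]
    exact hζ.1
  obtain ⟨f, hf, h⟩ := (Loc.tensor_eq_zero_iff _).1 h2
  refine ⟨act f c, ⟨c, ?_⟩, ?_, (Loc.act_eq hf c).symm⟩
  · rw [act_sub, sub_eq_zero, act_tmul] at h
    rw [map_act, h]
  · rw [map_act, selfModule_act]; exact hf.mul h1

/-- The total space of the spectral sheaf: its stalk at `x` is the set of grouplike elements of
`C_x`. -/
structure Coalg.Sp (C : Coalg (Rc 𝕜 n M)) : Type u where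
  pt : M
  val : Loc 𝕜 n pt C
  grouplike : C.Grouplike pt val

theorem Coalg.Sp.ext' {C : Coalg (Rc 𝕜 n M)} {p q : C.Sp} (h : p.pt = q.pt)
    (h' : HEq p.val q.val) : p = q := by
  cases p; cases q; cases h; cases h'; rfl

/-- The set `c_W` of the classes `c_x` with `x ∈ W`. -/
def Coalg.basic (C : Coalg (Rc 𝕜 n M)) (c : C) (W : Set M) : Set C.Sp :=
  {p | p.pt ∈ W ∧ p.val = Loc.mk 𝕜 n p.pt c}

/-- The sets `c_W`, for `W` open and `c` weakly grouplike and normalized on `W`. -/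
def Coalg.basis (C : Coalg (Rc 𝕜 n M)) : Set (Set C.Sp) :=
  {S | ∃ (c : C) (W : Set M), IsOpen W ∧ C.WeaklyGrouplike c ∧ (∀ x ∈ W, OneAt (C.counit c) x) ∧
    S = C.basic c W}

instance (C : Coalg (Rc 𝕜 n M)) : TopologicalSpace C.Sp :=
  TopologicalSpace.generateFrom C.basis

theorem Coalg.isTopologicalBasis (C : Coalg (Rc 𝕜 n M)) :
    TopologicalSpace.IsTopologicalBasis C.basis where
  eq_generateFrom := rfl
  sUnion_eq := by
    refine Set.eq_univ_of_forall fun p => ?_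
    obtain ⟨c, hc, h1, h2⟩ := p.grouplike.exists_rep
    obtain ⟨W, hW, hWo, hx⟩ := mem_nhds_iff.1 (eventually_eventually_nhds.2 h1)
    exact ⟨_, ⟨c, W, hWo, hc, fun x hx => hW hx, rfl⟩, hx, h2⟩
  exists_subset_inter := by
    rintro _ ⟨c, W, hW, hc, hcW, rfl⟩ _ ⟨d, V, hV, hd, hdV, rfl⟩ p ⟨⟨hp1, hp2⟩, hp3, hp4⟩
    obtain ⟨f, hf, h⟩ := (Submodule.Quotient.eq _).1 (hp2.symm.trans hp4)
    obtain ⟨X, hX, hXo, hx⟩ := mem_nhds_iff.1 (eventually_eventually_nhds.2 hf)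
    refine ⟨_, ⟨c, W ∩ V ∩ X, (hW.inter hV).inter hXo, hc, fun x hx => hcW x hx.1.1, rfl⟩,
      ⟨⟨⟨hp1, hp3⟩, hx⟩, hp2⟩, ?_⟩
    rintro q ⟨⟨⟨hq1, hq2⟩, hq3⟩, hq4⟩
    exact ⟨⟨hq1, hq4⟩, hq2, hq4.trans ((Submodule.Quotient.eq _).2 ⟨f, hX hq3, h⟩)⟩

theorem Coalg.sp_homeo (C : Coalg (Rc 𝕜 n M)) : IsLocalHomeomorph (fun p : C.Sp => p.pt) := by
  have hcont : Continuous (fun p : C.Sp => p.pt) := by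
    refine continuous_def.2 fun V hV => C.isTopologicalBasis.isOpen_iff.2 fun p hp => ?_
    obtain ⟨_, ⟨c, W, hW, hc, hcW, rfl⟩, hpS, -⟩ :=
      C.isTopologicalBasis.mem_nhds_iff.1 (univ_mem (f := 𝓝 p))
    exact ⟨_, ⟨c, W ∩ V, hW.inter hV, hc, fun x hx => hcW x hx.1, rfl⟩, ⟨⟨hpS.1, hp⟩, hpS.2⟩,
      fun q hq => hq.1.2⟩
  have hopen : IsOpenMap (fun p : C.Sp => p.pt) := by
    refine C.isTopologicalBasis.isOpenMap_iff.2 ?_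
    rintro _ ⟨c, W, hW, hc, hcW, rfl⟩
    convert hW
    ext x
    refine ⟨?_, fun hx => ⟨⟨x, _, hc.grouplike (hcW x hx)⟩, ⟨hx, rfl⟩, rfl⟩⟩
    rintro ⟨p, hp, rfl⟩
    exact hp.1
  refine isLocalHomeomorph_iff_isOpenEmbedding_restrict.2 fun p => ?_
  obtain ⟨S, hS, hpS, -⟩ := C.isTopologicalBasis.mem_nhds_iff.1 (univ_mem (f := 𝓝 p))
  have hSo := C.isTopologicalBasis.isOpen hS
  refine ⟨S, hSo.mem_nhds hpS, .of_continuous_injective_isOpenMap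
    (hcont.comp continuous_subtype_val) ?_ (hopen.comp hSo.isOpenMap_subtype_val)⟩
  obtain ⟨c, W, hW, hc, hcW, rfl⟩ := hS
  rintro ⟨⟨x, ζ, h1⟩, hp⟩ ⟨⟨y, ξ, h2⟩, hq⟩ h
  obtain rfl : x = y := h
  obtain rfl : ζ = ξ := hp.2.trans hq.2.symm
  rfl

/-- The spectral sheaf of a coalgebra. -/
def Coalg.spectral (C : Coalg (Rc 𝕜 n M)) : Shf n M :=
  Shf.ofLocalHomeo _ C.sp_homeo

theorem Coalg.Grouplike.map {C D : Coalg (Rc 𝕜 n M)} (α : C ⟶ D) {x : M} {ζ : Loc 𝕜 n x C}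
    (hζ : C.Grouplike x ζ) : D.Grouplike x (Loc.map x α.lin ζ) := by
  obtain ⟨c, rfl⟩ := Submodule.mkQ_surjective _ ζ
  have h1 : C.counitAt x (Loc.mk 𝕜 n x c) = 1 := hζ.2
  have h2 := hζ.1
  refine ⟨?_, ?_⟩
  · have key : ∀ t : C ⊗[Uz (Rc 𝕜 n M)] C,
        Loc.tensor 𝕜 n x D (TensorProduct.map α.lin α.lin t) =
          TensorProduct.map (Loc.map x α.lin) (Loc.map x α.lin) (Loc.tensor 𝕜 n x C t) := by
      intro t
      induction t using TensorProduct.induction_on with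
      | zero => simp
      | tmul c d => rfl
      | add s t hs ht => simp only [map_add, hs, ht]
    change Loc.tensor 𝕜 n x D (D.comul (α.lin c)) = _
    rw [← α.comul_comp, key]
    exact congrArg (TensorProduct.map (Loc.map x α.lin) (Loc.map x α.lin)) h2
  · rw [C.counitAt_mk_eq_one, ← α.counit_comp] at h1
    exact (D.counitAt_mk_eq_one x _).2 h1

/-- The map induced by a homomorphism of coalgebras, given by `α_x` on the stalk at `x`. -/
def Coalg.Sp.map {C D : Coalg (Rc 𝕜 n M)} (α : C ⟶ D) (p : C.Sp) : D.Sp :=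
  ⟨p.pt, Loc.map p.pt α.lin p.val, p.grouplike.map α⟩

theorem Coalg.Sp.continuous_map {C D : Coalg (Rc 𝕜 n M)} (α : C ⟶ D) :
    Continuous (Coalg.Sp.map α) := by
  refine continuous_iff_continuousAt.2 fun p => ?_
  obtain ⟨c, hc, h1, h2⟩ := p.grouplike.exists_rep
  refine (D.isTopologicalBasis.nhds_hasBasis.tendsto_right_iff).2 ?_
  rintro _ ⟨⟨d, V, hV, hd, hdV, rfl⟩, hp1, hp2⟩
  have h3 : Loc.mk 𝕜 n p.pt (α.lin c) = Loc.mk 𝕜 n p.pt d := by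
    refine Eq.trans ?_ hp2
    change _ = Loc.map p.pt α.lin p.val
    rw [h2]; rfl
  obtain ⟨f, hf, h⟩ := (Submodule.Quotient.eq _).1 h3
  obtain ⟨X, hX, hXo, hx⟩ := mem_nhds_iff.1
    (eventually_eventually_nhds.2 (hf.and (h1.and (hV.mem_nhds hp1))))
  have hX' : ∀ y ∈ X, OneAt f y ∧ OneAt (C.counit c) y ∧ y ∈ V := fun y hy =>
    ⟨(hX hy).mono fun _ h => h.1, (hX hy).mono fun _ h => h.2.1, (hX hy).self_of_nhds.2.2⟩
  refine Filter.mem_of_superset ((C.isTopologicalBasis.isOpen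
    ⟨c, X, hXo, hc, fun y hy => (hX' y hy).2.1, rfl⟩).mem_nhds ⟨hx, h2⟩) ?_
  rintro q ⟨hq1, hq2⟩
  refine ⟨(hX' _ hq1).2.2, ?_⟩
  change Loc.map q.pt α.lin q.val = _
  rw [hq2]
  exact (Submodule.Quotient.eq _).2 ⟨f, (hX' _ hq1).1, h⟩

variable (𝕜 n M) in
/-- The spectral sheaf functor. -/
def spectralFunctor : Coalg (Rc 𝕜 n M) ⥤ Shf n M where
  obj C := C.spectral
  map {C D} α := Shf.homMk (E := C.spectral) (F := D.spectral) (Coalg.Sp.map α)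
    (Coalg.Sp.continuous_map α) fun _ => rfl
  map_id C := Shf.Hom.ext' fun p => by
    refine Coalg.Sp.ext' rfl (heq_of_eq ?_)
    obtain ⟨c, hc⟩ := Submodule.mkQ_surjective _ p.val
    change Loc.map p.pt LinearMap.id p.val = p.val
    rw [← hc]; rfl
  map_comp {C D B} α β := Shf.Hom.ext' fun p => by
    refine Coalg.Sp.ext' rfl (heq_of_eq ?_)
    obtain ⟨c, hc⟩ := Submodule.mkQ_surjective _ p.val
    change Loc.map p.pt (β.lin ∘ₗ α.lin) p.val = Loc.map p.pt β.lin (Loc.map p.pt α.lin p.val)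
    rw [← hc]; rfl

end Spectral

/-! ### Smooth functions with compact support on the total space of a sheaf -/

section Sections

variable {𝕜 : Type} [RCLike 𝕜] {n : ℕ} {M : Type u} [TopologicalSpace M]
  [ChartedSpace (EuclideanSpace ℝ (Fin n)) M] [IsManifold (𝓡 n) ∞ M]

theorem Shf.Elementary.mono {E : Shf n M} {U V : Set E} (hU : E.Elementary U) (hV : IsOpen V)
    (h : V ⊆ U) : E.Elementary V := ⟨hV, hU.2.mono h⟩

theorem Shf.exists_elementary (E : Shf n M) (y : E) {W : Set E} (hW : W ∈ 𝓝 y) :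
    ∃ V, E.Elementary V ∧ y ∈ V ∧ V ⊆ W := by
  obtain ⟨V, hVW, hVo, hy⟩ := mem_nhds_iff.1 hW
  obtain ⟨V', hVo', hy', hV'⟩ : ∃ V', IsOpen V' ∧ y ∈ V' ∧ Set.InjOn E.proj V' :=
    ⟨_, (E.homeo y).choose.open_source, (E.homeo y).choose_spec.1, by
      have h := (E.homeo y).choose.injOn
      rwa [← (E.homeo y).choose_spec.2] at h⟩
  exact ⟨V ∩ V', ⟨hVo.inter hVo', hV'.mono Set.inter_subset_right⟩, ⟨hy, hy'⟩,
    Set.inter_subset_left.trans hVW⟩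

theorem Shf.Elementary.exists_section {E : Shf n M} {U : Set E} (hU : E.Elementary U)
    (hne : U.Nonempty) : ∃ s : M → E, ContMDiffOn (𝓡 n) (𝓡 n) ∞ s (E.proj '' U) ∧
      ∀ y ∈ U, s (E.proj y) = y := by
  have : Nonempty E := hne.to_type
  have hs : ∀ y ∈ U, Function.invFunOn E.proj U (E.proj y) = y :=
    fun y hy => hU.2.leftInvOn_invFunOn hy
  refine ⟨Function.invFunOn E.proj U, ?_, hs⟩
  rintro _ ⟨y, hy, rfl⟩
  refine ContMDiffAt.contMDiffWithinAt (contMDiffAt_of_comp E.isLocalDiffeo ?_ ?_)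
  · rw [ContinuousAt, hs y hy, ← E.homeo.map_nhds_eq, tendsto_map'_iff]
    refine tendsto_id.congr' ?_
    filter_upwards [hU.1.mem_nhds hy] with z hz
    exact (hs z hz).symm
  · refine contMDiffAt_id.congr_of_eventuallyEq ?_
    filter_upwards [(E.homeo.isOpenMap U hU.1).mem_nhds ⟨y, hy, rfl⟩]
    rintro _ ⟨z, hz, rfl⟩
    simp [hs z hz]

variable (𝕜) in
/-- Global sections, not necessarily continuous, of the sheaf of germs of functions on `E`. -/
def Sections (E : Shf n M) : Type u := ∀ y : E, Germ (𝓝 y) 𝕜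

instance (E : Shf n M) : CommRing (Sections 𝕜 E) :=
  inferInstanceAs (CommRing (∀ y : E, Germ (𝓝 y) 𝕜))

/-- The module structure on sections: `(p u)_y` is the product of the germ of `p ∘ π` and `u_y`. -/
instance (E : Shf n M) : Module (Uz (Rc 𝕜 n M)) (Sections 𝕜 E) :=
  Module.compHom (Sections 𝕜 E) (Uz.lift (S := Sections 𝕜 E)
    { toFun := fun p y => (((p : M → 𝕜) ∘ E.proj : E → 𝕜) : Germ (𝓝 y) 𝕜)
      map_mul' := fun _ _ => rfl
      map_zero' := rfl
      map_add' := fun _ _ => rfl })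

theorem act_apply {E : Shf n M} (p : Rc 𝕜 n M) (u : Sections 𝕜 E) (y : E) :
    (act p u : Sections 𝕜 E) y = ((p.1 ∘ E.proj : E → 𝕜) : Germ (𝓝 y) 𝕜) * u y := by
  change ((Uz.lift (S := Sections 𝕜 E) _ (Uz.of p)) * u : Sections 𝕜 E) y = _
  rw [Uz.lift_of]; rfl

open Classical in
/-- The section which is the germ of `f` at the points of `U` and zero elsewhere. -/
def extByZero {E : Shf n M} (U : Set E) (f : E → 𝕜) : Sections 𝕜 E :=
  fun y => if y ∈ U then (f : Germ (𝓝 y) 𝕜) else 0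

theorem extByZero_of_mem {E : Shf n M} {U : Set E} {f : E → 𝕜} {y : E} (hy : y ∈ U) :
    extByZero U f y = (f : Germ (𝓝 y) 𝕜) := if_pos hy

theorem extByZero_of_notMem {E : Shf n M} {U : Set E} {f : E → 𝕜} {y : E} (hy : y ∉ U) :
    extByZero U f y = 0 := if_neg hy

theorem extByZero_add {E : Shf n M} (U : Set E) (f g : E → 𝕜) :
    extByZero U (f + g) = extByZero U f + extByZero U g := by
  funext y
  change _ = extByZero U f y + extByZero U g y
  by_cases hy : y ∈ U
  · simp only [extByZero_of_mem hy]; rfl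
  · simp only [extByZero_of_notMem hy, add_zero]

theorem extByZero_neg {E : Shf n M} (U : Set E) (f : E → 𝕜) :
    extByZero U (-f) = -extByZero U f := by
  funext y
  change _ = -extByZero U f y
  by_cases hy : y ∈ U
  · simp only [extByZero_of_mem hy]; rfl
  · simp only [extByZero_of_notMem hy, neg_zero]

theorem act_extByZero {E : Shf n M} (p : Rc 𝕜 n M) (U : Set E) (f : E → 𝕜) :
    act p (extByZero U f) = extByZero U ((p.1 ∘ E.proj) * f) := by
  funext y
  rw [act_apply]
  by_cases hy : y ∈ U
  · simp only [extByZero_of_mem hy]; rfl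
  · simp only [extByZero_of_notMem hy, mul_zero]

/-- `f` is smooth on `U` and has compact support in `U`. -/
def SmoothCompactOn {E : Shf n M} (U : Set E) (f : E → 𝕜) : Prop :=
  ContMDiffOn (𝓡 n) 𝓘(ℝ, 𝕜) ∞ f U ∧
    ∃ K, IsCompact K ∧ K ⊆ U ∧ ∀ y ∈ U, y ∉ K → f y = 0

theorem SmoothCompactOn.neg {E : Shf n M} {U : Set E} {f : E → 𝕜} (hf : SmoothCompactOn U f) :
    SmoothCompactOn U (-f) := by
  obtain ⟨hf, K, hK, hKU, hK0⟩ := hf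
  exact ⟨hf.neg, K, hK, hKU, fun y hy h => by simp [hK0 y hy h]⟩

theorem SmoothCompactOn.mul_left {E : Shf n M} {U : Set E} {f p : E → 𝕜}
    (hf : SmoothCompactOn U f) (hp : ContMDiffOn (𝓡 n) 𝓘(ℝ, 𝕜) ∞ p U) :
    SmoothCompactOn U (p * f) := by
  obtain ⟨hf, K, hK, hKU, hK0⟩ := hf
  exact ⟨contDiff_mul.contMDiff.comp_contMDiffOn (hp.prodMk_space hf), K, hK, hKU,
    fun y hy h => by simp [hK0 y hy h]⟩

theorem SmoothCompactOn.add {E : Shf n M} {U : Set E} {f p : E → 𝕜}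
    (hf : SmoothCompactOn U f) (hp : SmoothCompactOn U p) : SmoothCompactOn U (f + p) := by
  obtain ⟨hf, K, hK, hKU, hK0⟩ := hf
  obtain ⟨hp, L, hL, hLU, hL0⟩ := hp
  refine ⟨hf.add hp, K ∪ L, hK.union hL, Set.union_subset hKU hLU, fun y hy h => ?_⟩
  rw [Set.mem_union, not_or] at h
  simp [hK0 y hy h.1, hL0 y hy h.2]

variable (𝕜) in
/-- The extensions by zero of smooth functions with compact support in Hausdorff open subsets. -/
def generators (E : Shf n M) : Set (Sections 𝕜 E) :=
  {u | ∃ (U : Set E) (f : E → 𝕜), IsOpen U ∧ T2Space U ∧ SmoothCompactOn U f ∧ u = extByZero U f}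

variable (𝕜) in
/-- `C_c^∞(E)`: the finite sums of extensions by zero of smooth functions with compact support in
Hausdorff open subsets of `E`. -/
def Cc (E : Shf n M) : Submodule (Uz (Rc 𝕜 n M)) (Sections 𝕜 E) where
  __ := AddSubgroup.closure (generators 𝕜 E)
  smul_mem' := by
    intro a u hu
    change u ∈ AddSubgroup.closure _ at hu
    change a • u ∈ AddSubgroup.closure _
    induction a using Uz.induction with
    | h1 m => rw [Int.cast_smul_eq_zsmul]; exact AddSubgroup.zsmul_mem _ hu m
    | h2 p =>
      change act p u ∈ _
      induction hu using AddSubgroup.closure_induction with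
      | mem u hu =>
        obtain ⟨U, f, hU, hT, hf, rfl⟩ := hu
        rw [act_extByZero]
        exact AddSubgroup.subset_closure ⟨U, _, hU, hT, hf.mul_left
          (p.2.1.comp_contMDiffOn E.isLocalDiffeo.contMDiff.contMDiffOn), rfl⟩
      | zero => rw [act_zero]; exact zero_mem _
      | add u v _ _ hu hv => rw [act_add]; exact add_mem hu hv
      | neg u _ hu => rw [act, smul_neg]; exact neg_mem hu
    | h3 a b ha hb => rw [add_smul]; exact add_mem ha hb

/-- `U` is elementary and `f` has support in `π(U)`. -/
structure Adapted {E : Shf n M} (U : Set E) (f : Rc 𝕜 n M) : Prop where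
  elementary : E.Elementary U
  supp : tsupport f.1 ⊆ E.proj '' U

theorem Adapted.smoothCompactOn {E : Shf n M} {U : Set E} {f : Rc 𝕜 n M} (h : Adapted U f) :
    SmoothCompactOn U (f.1 ∘ E.proj) := by
  refine ⟨f.2.1.comp_contMDiffOn E.isLocalDiffeo.contMDiff.contMDiffOn, ?_⟩
  rcases U.eq_empty_or_nonempty with rfl | hne
  · exact ⟨∅, isCompact_empty, subset_rfl, by simp⟩
  obtain ⟨s, hs, hs'⟩ := h.elementary.exists_section hne
  refine ⟨s '' tsupport f.1, f.2.2.isCompact.image_of_continuousOn (hs.continuousOn.mono h.supp),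
    ?_, fun y hy hyK => ?_⟩
  · rintro _ ⟨x, hx, rfl⟩
    obtain ⟨y, hy, rfl⟩ := h.supp hx
    rwa [hs' y hy]
  · by_contra h0
    exact hyK ⟨E.proj y, subset_tsupport _ h0, hs' y hy⟩

theorem Adapted.of_zero {E : Shf n M} {U : Set E} {f : Rc 𝕜 n M} (h : Adapted U f)
    {g : Rc 𝕜 n M} (hg : ∀ x, f x = 0 → g x = 0) : Adapted U g :=
  ⟨h.elementary, (closure_mono fun x (hx : g x ≠ 0) h0 => hx (hg x h0)).trans h.supp⟩

theorem Adapted.mul {E : Shf n M} {U : Set E} {f : Rc 𝕜 n M} (h : Adapted U f) (r : Rc 𝕜 n M) :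
    Adapted U (r * f) := h.of_zero fun x hx => by simp [hx]

variable [T2Space M]

theorem Adapted.mem_generators {E : Shf n M} {U : Set E} {f : Rc 𝕜 n M} (h : Adapted U f) :
    extByZero U (f.1 ∘ E.proj) ∈ generators 𝕜 E := by
  refine ⟨U, _, h.elementary.1, ?_, h.smoothCompactOn, rfl⟩
  exact T2Space.of_injective_continuous (f := fun y : U => E.proj y)
    (fun a b hab => Subtype.ext (h.elementary.2 a.2 b.2 hab))
    (E.homeo.continuous.comp continuous_subtype_val)

/-- The function `f ∘ π|_U`, extended by zero. -/
def Cc.piece {E : Shf n M} (U : Set E) (f : Rc 𝕜 n M) (h : Adapted U f) : Cc 𝕜 E :=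
  ⟨extByZero U (f.1 ∘ E.proj), AddSubgroup.subset_closure h.mem_generators⟩

variable (𝕜) in
/-- The sums of functions `f ∘ π|_U`. -/
def pieces (E : Shf n M) : AddSubmonoid (Sections 𝕜 E) :=
  AddSubmonoid.closure {u | ∃ (U : Set E) (f : Rc 𝕜 n M), Adapted U f ∧
    u = extByZero U (f.1 ∘ E.proj)}

/-- A partition of unity argument on a Hausdorff open subset. -/
theorem extByZero_mem_pieces {E : Shf n M} {U : Set E} (hU : IsOpen U) (hT : T2Space U)
    {f : E → 𝕜} (hf : SmoothCompactOn U f) : extByZero U f ∈ pieces 𝕜 E := by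
  have hsub : ∀ K : Set E, IsCompact K → K ⊆ U → ∃ ψ : E → 𝕜,
      ContMDiffOn (𝓡 n) 𝓘(ℝ, 𝕜) ∞ ψ U ∧ (∀ y ∈ K, ψ y = 1) ∧
        ∀ f, SmoothCompactOn U f → extByZero U (ψ * f) ∈ pieces 𝕜 E := by
    intro K hK hKU
    refine hK.induction_on (p := fun K => ∃ ψ : E → 𝕜,
      ContMDiffOn (𝓡 n) 𝓘(ℝ, 𝕜) ∞ ψ U ∧ (∀ y ∈ K, ψ y = 1) ∧
        ∀ f, SmoothCompactOn U f → extByZero U (ψ * f) ∈ pieces 𝕜 E) ?_ ?_ ?_ ?_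
    · refine ⟨0, contMDiffOn_const, by simp, fun f hf => ?_⟩
      have : extByZero U ((0 : E → 𝕜) * f) = 0 := by
        funext y
        by_cases hy : y ∈ U
        · rw [extByZero_of_mem hy, zero_mul]; rfl
        · rw [extByZero_of_notMem hy]; rfl
      rw [this]; exact zero_mem _
    · exact fun s t hst ⟨ψ, h1, h2, h3⟩ => ⟨ψ, h1, fun y hy => h2 y (hst hy), h3⟩
    · rintro s t ⟨ψ, h1, h2, h3⟩ ⟨θ, g1, g2, g3⟩
      have h4 : ContMDiffOn (𝓡 n) 𝓘(ℝ, 𝕜) ∞ (1 - ψ) U :=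
        (contMDiffOn_const (c := (1 : 𝕜))).sub h1
      have h5 : ContMDiffOn (𝓡 n) 𝓘(ℝ, 𝕜) ∞ (θ * (1 - ψ)) U :=
        contDiff_mul.contMDiff.comp_contMDiffOn (g1.prodMk_space h4)
      refine ⟨ψ + θ * (1 - ψ), h1.add h5, ?_, fun f hf => ?_⟩
      · rintro y (hy | hy)
        · simp [h2 y hy]
        · simp [g2 y hy]
      · have : (ψ + θ * (1 - ψ)) * f = ψ * f + θ * (f + -(ψ * f)) := by ring
        rw [this, extByZero_add]
        exact add_mem (h3 f hf) (g3 _ (hf.add (hf.mul_left h1).neg))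
    · intro y hyK
      obtain ⟨V, hV, hyV, hVU⟩ := E.exists_elementary y (hU.mem_nhds (hKU hyK))
      obtain ⟨s, hs, hs'⟩ := hV.exists_section ⟨y, hyV⟩
      have hVo := E.homeo.isOpenMap V hV.1
      obtain ⟨b, hb, hbV⟩ := exists_bump (𝕜 := 𝕜) (n := n) (E.proj y) (hVo.mem_nhds ⟨y, hyV, rfl⟩)
      classical
      set ψ : E → 𝕜 := fun w => if w ∈ V then b (E.proj w) else 0 with hψ
      have hψV : ∀ w ∈ V, ψ =ᶠ[𝓝 w] b.1 ∘ E.proj := fun w hw => by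
        filter_upwards [hV.1.mem_nhds hw] with z hz
        simp [hψ, hz]
      have hL : IsCompact (s '' tsupport b.1) :=
        b.2.2.isCompact.image_of_continuousOn (hs.continuousOn.mono hbV)
      have hψ0 : ∀ w ∈ U, w ∉ V → ψ =ᶠ[𝓝 w] 0 := fun w hw hwV => by
        have hLU : s '' tsupport b.1 ⊆ V := by
          rintro _ ⟨x, hx, rfl⟩
          obtain ⟨z, hz, rfl⟩ := hbV hx
          rwa [hs' z hz]
        have h1 : IsCompact (Subtype.val ⁻¹' (s '' tsupport b.1) : Set U) := by
          refine Topology.IsInducing.subtypeVal.isCompact_preimage_iff ?_ |>.2 hL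
          rw [Subtype.range_coe]; exact hLU.trans hVU
        have h2 := hU.isOpenMap_subtype_val _ h1.isClosed.isOpen_compl
        filter_upwards [h2.mem_nhds ⟨⟨w, hw⟩, fun h => hwV (hLU h), rfl⟩]
        rintro _ ⟨⟨z, hz⟩, hzL, rfl⟩
        by_cases hzV : z ∈ V
        · have : b (E.proj z) = 0 := by
            by_contra h0
            exact hzL ⟨E.proj z, subset_tsupport _ h0, hs' z hzV⟩
          simp [hψ, this]
        · simp [hψ, hzV]
      have hψs : ContMDiffOn (𝓡 n) 𝓘(ℝ, 𝕜) ∞ ψ U := by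
        intro w hw
        refine ContMDiffAt.contMDiffWithinAt ?_
        by_cases hwV : w ∈ V
        · exact ((b.2.1.comp E.isLocalDiffeo.contMDiff) w).congr_of_eventuallyEq (hψV w hwV)
        · exact (contMDiffAt_const (c := (0 : 𝕜))).congr_of_eventuallyEq (hψ0 w hw hwV)
      refine ⟨{z | ψ z = 1}, ?_, ψ, hψs, fun z hz => hz, fun f hf => ?_⟩
      · refine mem_nhdsWithin_of_mem_nhds ?_
        filter_upwards [hψV y hyV, E.homeo.continuous.continuousAt.eventually hb] with z hz hz'
        exact hz.trans hz'
      · let h : M → 𝕜 := fun x => b x * f (s x)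
        have hsupp : tsupport h ⊆ tsupport b.1 := closure_mono fun x hx => by
          intro h0
          exact hx (by simp [h, show b x = 0 from h0])
        have hh : ContMDiff (𝓡 n) 𝓘(ℝ, 𝕜) ∞ h := by
          refine contMDiff_of_tsupport fun x hx => ?_
          have hxV := hbV (hsupp hx)
          obtain ⟨z, hz, rfl⟩ := id hxV
          have e1 : ContMDiffAt (𝓡 n) 𝓘(ℝ, 𝕜) ∞ f (s (E.proj z)) := by
            rw [hs' z hz]; exact hf.1.contMDiffAt (hU.mem_nhds (hVU hz))
          have e2 : ContMDiffAt (𝓡 n) 𝓘(ℝ, 𝕜) ∞ (f ∘ s) (E.proj z) :=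
            e1.comp _ (hs.contMDiffAt (hVo.mem_nhds hxV))
          exact contDiff_mul.contMDiff.contMDiffAt.comp _ ((b.2.1 _).prodMk_space e2)
        refine AddSubmonoid.subset_closure ⟨V, ⟨h, hh, b.2.2.mono' (subset_closure.trans hsupp)⟩,
          ⟨hV, hsupp.trans hbV⟩, ?_⟩
        funext w
        by_cases hwV : w ∈ V
        · rw [extByZero_of_mem hwV, extByZero_of_mem (hVU hwV), Germ.coe_eq]
          filter_upwards [hψV w hwV, hV.1.mem_nhds hwV] with z hz hzV
          simp [hz, h, hs' z hzV]
        · rw [extByZero_of_notMem hwV]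
          by_cases hwU : w ∈ U
          · rw [extByZero_of_mem hwU]
            refine (Germ.coe_eq (f := ψ * f) (g := 0)).2 ?_
            filter_upwards [hψ0 w hwU hwV] with z hz
            simp [hz]
          · rw [extByZero_of_notMem hwU]
  obtain ⟨K, hK, hKU, hK0⟩ := hf.2
  obtain ⟨ψ, h1, h2, h3⟩ := hsub K hK hKU
  have : extByZero U f = extByZero U (ψ * f) := by
    funext y
    by_cases hy : y ∈ U
    · rw [extByZero_of_mem hy, extByZero_of_mem hy, Germ.coe_eq]
      filter_upwards [hU.mem_nhds hy] with z hz
      by_cases hzK : z ∈ K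
      · simp [h2 z hzK]
      · simp [hK0 z hz hzK]
    · rw [extByZero_of_notMem hy, extByZero_of_notMem hy]
  rw [this]
  exact h3 f hf

theorem Cc.mem_pieces {E : Shf n M} {u : Sections 𝕜 E} (hu : u ∈ Cc 𝕜 E) : u ∈ pieces 𝕜 E := by
  change u ∈ AddSubgroup.closure (generators 𝕜 E) at hu
  rw [← AddSubgroup.mem_toAddSubmonoid, AddSubgroup.closure_toAddSubmonoid] at hu
  refine AddSubmonoid.closure_le.2 ?_ hu
  rintro u (⟨U, f, hU, hT, hf, rfl⟩ | ⟨U, f, hU, hT, hf, hu⟩)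
  · exact extByZero_mem_pieces hU hT hf
  · rw [← neg_neg u, hu, ← extByZero_neg]
    exact extByZero_mem_pieces hU hT hf.neg

/-- Every element of `C_c^∞(E)` is a sum of functions of the form `f ∘ π|_U`. -/
theorem Cc.induction {E : Shf n M} {p : Cc 𝕜 E → Prop} (hz : p 0)
    (hp : ∀ U f h, p (Cc.piece U f h)) (ha : ∀ u v, p u → p v → p (u + v)) (u : Cc 𝕜 E) : p u := by
  have key : ∀ v ∈ pieces 𝕜 E, ∃ h : v ∈ Cc 𝕜 E, p ⟨v, h⟩ := by
    intro v hv
    induction hv using AddSubmonoid.closure_induction with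
    | mem v hv => obtain ⟨U, f, h, rfl⟩ := hv; exact ⟨_, hp U f h⟩
    | zero => exact ⟨zero_mem _, hz⟩
    | add v w _ _ hv hw => exact ⟨add_mem hv.1 hw.1, ha _ _ hv.2 hw.2⟩
  exact (key u.1 (Cc.mem_pieces u.2)).2

theorem Cc.piece_congr {E : Shf n M} {U V : Set E} {f g : Rc 𝕜 n M} (hU : U = V) (hf : f = g)
    (h : Adapted U f) : Cc.piece U f h = Cc.piece V g (hU ▸ hf ▸ h) := by
  subst hU; subst hf; rfl

theorem Cc.act_piece {E : Shf n M} {U : Set E} {f : Rc 𝕜 n M} (h : Adapted U f) (r : Rc 𝕜 n M) :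
    act r (Cc.piece U f h) = Cc.piece U (r * f) (h.mul r) :=
  Subtype.ext (act_extByZero r U _)

end Sections

/-! ### Functoriality of smooth functions with compact support -/

section Pushforward

variable {𝕜 : Type} [RCLike 𝕜] {n : ℕ} {M : Type u} [TopologicalSpace M]
  [ChartedSpace (EuclideanSpace ℝ (Fin n)) M] [IsManifold (𝓡 n) ∞ M]

theorem Uz.map_smul_of_act {R : Type u} [NonUnitalCommRing R] {C D : Type*} [AddCommGroup C]
    [Module (Uz R) C] [AddCommGroup D] [Module (Uz R) D] (f : C →+ D)
    (h : ∀ (r : R) (c : C), f (act r c) = act r (f c)) (a : Uz R) (c : C) : f (a • c) = a • f c := by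
  induction a using Uz.induction with
  | h1 m => rw [Int.cast_smul_eq_zsmul, Int.cast_smul_eq_zsmul, map_zsmul]
  | h2 r => exact h r c
  | h3 a b ha hb => rw [add_smul, add_smul, map_add, ha, hb]

/-- The pullback `φ^*` of germs along a continuous map. -/
def germPull {X Y : Type u} [TopologicalSpace X] [TopologicalSpace Y] (φ : X → Y)
    (hφ : Continuous φ) {y : X} {z : Y} (h : φ y = z) : Germ (𝓝 z) 𝕜 →+* Germ (𝓝 y) 𝕜 where
  toFun g := g.compTendsto φ (h ▸ hφ.continuousAt)
  map_one' := rfl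
  map_zero' := rfl
  map_add' g k := by
    induction g, k using Germ.inductionOn₂; rfl
  map_mul' g k := by
    induction g, k using Germ.inductionOn₂; rfl

theorem germPull_coe {X Y : Type u} [TopologicalSpace X] [TopologicalSpace Y] (φ : X → Y)
    (hφ : Continuous φ) {y : X} {z : Y} (h : φ y = z) (f : Y → 𝕜) :
    germPull φ hφ h (f : Germ (𝓝 z) 𝕜) = ((f ∘ φ : X → 𝕜) : Germ (𝓝 y) 𝕜) := rfl

theorem germPull_bijective {X Y : Type u} [TopologicalSpace X] [TopologicalSpace Y] (φ : X → Y)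
    (hφ : IsLocalHomeomorph φ) {y : X} {z : Y} (h : φ y = z) :
    Function.Bijective (germPull (𝕜 := 𝕜) φ hφ.continuous h) := by
  subst h
  constructor
  · intro g k
    induction g, k using Germ.inductionOn₂ with | _ g k
    intro hgk
    rw [germPull_coe, germPull_coe, Germ.coe_eq] at hgk
    rw [Germ.coe_eq, EventuallyEq, ← hφ.map_nhds_eq]
    exact eventually_map.2 hgk
  · intro g
    induction g using Germ.inductionOn with | _ g
    refine ⟨((g ∘ (hφ y).choose.symm : Y → 𝕜) : Germ (𝓝 (φ y)) 𝕜), ?_⟩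
    rw [germPull_coe, Germ.coe_eq]
    filter_upwards [(hφ y).choose.open_source.mem_nhds (hφ y).choose_spec.1] with w hw
    have h1 := (hφ y).choose.left_inv hw
    have h2 : φ w = (hφ y).choose w := congrFun (hφ y).choose_spec.2 w
    simp only [Function.comp_apply, h2]
    rw [h1]

/-- The isomorphism `φ_y^*` of germs, for a local homeomorphism `φ`. -/
def germEquiv {X Y : Type u} [TopologicalSpace X] [TopologicalSpace Y] (φ : X → Y)
    (hφ : IsLocalHomeomorph φ) {y : X} {z : Y} (h : φ y = z) : Germ (𝓝 z) 𝕜 ≃+* Germ (𝓝 y) 𝕜 :=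
  RingEquiv.ofBijective _ (germPull_bijective φ hφ h)

theorem germEquiv_symm_coe {X Y : Type u} [TopologicalSpace X] [TopologicalSpace Y] (φ : X → Y)
    (hφ : IsLocalHomeomorph φ) {y : X} {z : Y} (h : φ y = z) (f : Y → 𝕜) :
    (germEquiv φ hφ h).symm ((f ∘ φ : X → 𝕜) : Germ (𝓝 y) 𝕜) = (f : Germ (𝓝 z) 𝕜) :=
  (RingEquiv.symm_apply_eq _).2 rfl

/-- `φ_+(u)_z = ∑ φ_{*y}(u_y)`, the sum over the points `y` with `φ(y) = z`, where `φ_{*y}` is the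
inverse of `φ_y^*`. -/
def pushFun {E F : Shf n M} (φ : E ⟶ F) (u : Sections 𝕜 E) : Sections 𝕜 F :=
  fun z => ∑ᶠ y : φ.toFun ⁻¹' {z}, (germEquiv φ.toFun φ.homeo y.2).symm (u y.1)

theorem pushFun_zero {E F : Shf n M} (φ : E ⟶ F) : pushFun φ (0 : Sections 𝕜 E) = 0 := by
  funext z
  exact finsum_eq_zero_of_forall_eq_zero fun y => map_zero _

theorem pushFun_extByZero {E F : Shf n M} (φ : E ⟶ F) {U : Set E} (hU : Set.InjOn φ.toFun U)
    (f : M → 𝕜) : pushFun φ (extByZero U (f ∘ E.proj)) = extByZero (φ.toFun '' U) (f ∘ F.proj) := by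
  funext z
  have hf : f ∘ E.proj = (f ∘ F.proj) ∘ φ.toFun := funext fun y => by simp [φ.proj_comp]
  by_cases hz : z ∈ φ.toFun '' U
  · rw [extByZero_of_mem hz]
    obtain ⟨y, hy, hyz⟩ := hz
    rw [pushFun, finsum_eq_single _ ⟨y, hyz⟩, extByZero_of_mem hy, hf]
    · exact germEquiv_symm_coe φ.toFun φ.homeo hyz _
    rintro ⟨w, hw⟩ hne
    have : w ∉ U := fun h => hne (Subtype.ext (hU h hy (hw.trans hyz.symm)))
    rw [extByZero_of_notMem this, map_zero]
  · rw [extByZero_of_notMem hz]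
    refine finsum_eq_zero_of_forall_eq_zero fun y => ?_
    rw [extByZero_of_notMem fun h => hz ⟨y.1, h, y.2⟩, map_zero]

theorem Shf.Elementary.injOn {E F : Shf n M} (φ : E ⟶ F) {U : Set E} (hU : E.Elementary U) :
    Set.InjOn φ.toFun U := fun y hy z hz h => hU.2 hy hz (by
  rw [← φ.proj_comp, ← φ.proj_comp, h])

theorem Shf.Elementary.image {E F : Shf n M} (φ : E ⟶ F) {U : Set E} (hU : E.Elementary U) :
    F.Elementary (φ.toFun '' U) := by
  refine ⟨φ.homeo.isOpenMap U hU.1, ?_⟩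
  rintro _ ⟨y, hy, rfl⟩ _ ⟨z, hz, rfl⟩ h
  rw [φ.proj_comp, φ.proj_comp] at h
  rw [hU.2 hy hz h]

theorem Adapted.image {E F : Shf n M} (φ : E ⟶ F) {U : Set E} {f : Rc 𝕜 n M} (h : Adapted U f) :
    Adapted (φ.toFun '' U) f := by
  refine ⟨h.elementary.image φ, fun x hx => ?_⟩
  obtain ⟨y, hy, rfl⟩ := h.supp hx
  exact ⟨_, ⟨y, hy, rfl⟩, φ.proj_comp y⟩

variable [T2Space M]

theorem Cc.finite_support {E F : Shf n M} (φ : E ⟶ F) (u : Cc 𝕜 E) (z : F) :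
    (Function.support fun y : φ.toFun ⁻¹' {z} =>
      (germEquiv φ.toFun φ.homeo y.2).symm (u.1 y.1)).Finite := by
  induction u using Cc.induction with
  | hz =>
    refine Set.finite_empty.subset fun y hy => hy ?_
    exact map_zero _
  | hp U f h =>
    refine Set.Subsingleton.finite ?_
    have key : ∀ y : φ.toFun ⁻¹' {z}, (germEquiv φ.toFun φ.homeo y.2).symm
        ((Cc.piece U f h).1 y.1) ≠ 0 → y.1 ∈ U := fun y hy => by
      by_contra hyU
      refine hy ?_
      change (germEquiv φ.toFun φ.homeo y.2).symm (extByZero U (f.1 ∘ E.proj) y.1) = 0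
      rw [extByZero_of_notMem hyU, map_zero]
    intro y hy w hw
    exact Subtype.ext (h.elementary.injOn φ (key y hy) (key w hw) (y.2.trans w.2.symm))
  | ha u v hu hv =>
    refine (hu.union hv).subset fun y hy => ?_
    by_contra h
    simp only [Set.mem_union, Function.mem_support, not_or, not_not] at h
    refine hy ?_
    change (germEquiv φ.toFun φ.homeo y.2).symm (u.1 y.1 + v.1 y.1) = 0
    rw [map_add, h.1, h.2, add_zero]

theorem pushFun_add {E F : Shf n M} (φ : E ⟶ F) (u v : Cc 𝕜 E) :
    pushFun φ (u + v).1 = pushFun φ u.1 + pushFun φ v.1 := by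
  funext z
  refine Eq.trans ?_ (finsum_add_distrib (Cc.finite_support φ u z) (Cc.finite_support φ v z))
  exact finsum_congr fun y => map_add _ _ _

theorem pushFun_mem {E F : Shf n M} (φ : E ⟶ F) (u : Cc 𝕜 E) : pushFun φ u.1 ∈ Cc 𝕜 F := by
  induction u using Cc.induction with
  | hz => rw [Submodule.coe_zero, pushFun_zero]; exact zero_mem _
  | hp U f h =>
    have := pushFun_extByZero φ (h.elementary.injOn φ) f.1
    exact this ▸ (Cc.piece _ f (h.image φ)).2
  | ha u v hu hv => rw [pushFun_add]; exact add_mem hu hv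

/-- `φ_+` as an additive map. -/
def Cc.pushAdd {E F : Shf n M} (φ : E ⟶ F) : Cc 𝕜 E →+ Cc 𝕜 F where
  toFun u := ⟨pushFun φ u.1, pushFun_mem φ u⟩
  map_zero' := Subtype.ext (pushFun_zero φ)
  map_add' u v := Subtype.ext (pushFun_add φ u v)

theorem Cc.pushAdd_piece {E F : Shf n M} (φ : E ⟶ F) {U : Set E} {f : Rc 𝕜 n M}
    (h : Adapted U f) : Cc.pushAdd φ (Cc.piece U f h) = Cc.piece _ f (h.image φ) :=
  Subtype.ext (pushFun_extByZero φ (h.elementary.injOn φ) f.1)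

/-- `φ_+ : C_c^∞(E) → C_c^∞(F)`. -/
def Cc.push {E F : Shf n M} (φ : E ⟶ F) : Cc 𝕜 E →ₗ[Uz (Rc 𝕜 n M)] Cc 𝕜 F where
  __ := Cc.pushAdd φ
  map_smul' := Uz.map_smul_of_act (Cc.pushAdd φ) fun r u => by
    induction u using Cc.induction with
    | hz => simp
    | hp U f h => rw [Cc.act_piece, Cc.pushAdd_piece, Cc.pushAdd_piece, Cc.act_piece]
    | ha u v hu hv => rw [act_add, map_add, map_add, act_add, hu, hv]

theorem Cc.push_piece {E F : Shf n M} (φ : E ⟶ F) {U : Set E} {f : Rc 𝕜 n M}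
    (h : Adapted U f) : Cc.push φ (Cc.piece U f h) = Cc.piece _ f (h.image φ) :=
  Cc.pushAdd_piece φ h

/-! ### The counit -/

theorem Cc.value_piece {U : Set (Shf.base n M)} {f : Rc 𝕜 n M} (h : Adapted U f) (x : M) :
    Germ.value ((Cc.piece U f h).1 x) = f x := by
  by_cases hx : x ∈ U
  · exact congrArg Germ.value (extByZero_of_mem (E := Shf.base n M) hx)
  · refine (congrArg Germ.value (extByZero_of_notMem (E := Shf.base n M) hx)).trans ?_
    have : x ∉ tsupport f.1 := fun hx' => hx (by
      obtain ⟨y, hy, rfl⟩ := h.supp hx'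
      exact hy)
    exact (image_eq_zero_of_notMem_tsupport this).symm

theorem Cc.value_mem (u : Cc 𝕜 (Shf.base n M)) :
    (fun x : M => Germ.value (u.1 x)) ∈ smoothCompact 𝕜 n M := by
  induction u using Cc.induction with
  | hz => exact zero_mem _
  | hp U f h =>
    have : (fun x : M => Germ.value ((Cc.piece U f h).1 x)) = f.1 :=
      funext fun x => Cc.value_piece h x
    rw [this]; exact f.2
  | ha u v hu hv =>
    have : (fun x : M => Germ.value ((u + v).1 x)) =
      (fun x : M => Germ.value (u.1 x)) + fun x : M => Germ.value (v.1 x) :=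
      funext fun x => map_add Germ.valueAddHom (u.1 x) (v.1 x)
    rw [this]; exact add_mem hu hv

/-- The identification of sections of germs on the Hausdorff manifold `M` with functions. -/
def Cc.ofBaseAdd : Cc 𝕜 (Shf.base n M) →+ Rc 𝕜 n M where
  toFun u := ⟨fun x => Germ.value (u.1 x), Cc.value_mem u⟩
  map_zero' := rfl
  map_add' u v := Rc.ext fun x => map_add Germ.valueAddHom (u.1 x) (v.1 x)

/-- The identification of sections of germs on the Hausdorff manifold `M` with functions. -/
def Cc.ofBase : Cc 𝕜 (Shf.base n M) →ₗ[Uz (Rc 𝕜 n M)] Rc 𝕜 n M where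
  __ := Cc.ofBaseAdd
  map_smul' := Uz.map_smul_of_act Cc.ofBaseAdd fun r u => by
    refine Rc.ext fun x => ?_
    rw [selfModule_act]
    exact (congrArg Germ.value (act_apply (E := Shf.base n M) r u.1 x)).trans
      (map_mul Germ.valueMulHom _ (u.1 x))

/-- The counit `π_+`. -/
def Cc.counit (E : Shf n M) : Cc 𝕜 E →ₗ[Uz (Rc 𝕜 n M)] Rc 𝕜 n M :=
  Cc.ofBase ∘ₗ Cc.push E.projHom

theorem Cc.counit_piece {E : Shf n M} {U : Set E} {f : Rc 𝕜 n M} (h : Adapted U f) :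
    Cc.counit E (Cc.piece U f h) = f := by
  refine Rc.ext fun x => ?_
  rw [Cc.counit, LinearMap.comp_apply, Cc.push_piece]
  exact Cc.value_piece _ x

/-! ### The comultiplication -/

/-- The projection `E ×_M F → E`. -/
def Shf.fst (E F : Shf n M) : E.fiberProd F ⟶ E :=
  Shf.homMk (E := E.fiberProd F) (fun p => p.1.1)
    (continuous_fst.comp continuous_subtype_val) fun _ => rfl

/-- The projection `E ×_M F → F`. -/
def Shf.snd (E F : Shf n M) : E.fiberProd F ⟶ F :=
  Shf.homMk (E := E.fiberProd F) (fun p => p.1.2)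
    (continuous_snd.comp continuous_subtype_val) fun p => p.2.symm

/-- `Ω(u ⊗ v)_{(y,z)}` is the product of the pullbacks of `u_y` and `v_z`. -/
def omegaFun {E F : Shf n M} (u : Sections 𝕜 E) (v : Sections 𝕜 F) :
    Sections 𝕜 (E.fiberProd F) := fun p =>
  germEquiv (Shf.fst E F).toFun (Shf.fst E F).homeo rfl (u ((Shf.fst E F).toFun p)) *
    germEquiv (Shf.snd E F).toFun (Shf.snd E F).homeo rfl (v ((Shf.snd E F).toFun p))

theorem omegaFun_add_left {E F : Shf n M} (u u' : Sections 𝕜 E) (v : Sections 𝕜 F) :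
    omegaFun (u + u') v = omegaFun u v + omegaFun u' v := by
  funext p
  exact (congrArg (· * _) (map_add _ _ _)).trans (add_mul _ _ _)

theorem omegaFun_add_right {E F : Shf n M} (u : Sections 𝕜 E) (v v' : Sections 𝕜 F) :
    omegaFun u (v + v') = omegaFun u v + omegaFun u v' := by
  funext p
  exact (congrArg (_ * ·) (map_add _ _ _)).trans (mul_add _ _ _)

theorem omegaFun_act_left {E F : Shf n M} (r : Rc 𝕜 n M) (u : Sections 𝕜 E) (v : Sections 𝕜 F) :
    omegaFun (act r u) v = act r (omegaFun u v) := by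
  funext p
  rw [act_apply, omegaFun, act_apply, map_mul, mul_assoc]
  rfl

theorem omegaFun_act_right {E F : Shf n M} (r : Rc 𝕜 n M) (u : Sections 𝕜 E) (v : Sections 𝕜 F) :
    omegaFun u (act r v) = act r (omegaFun u v) := by
  funext p
  rw [act_apply, omegaFun, act_apply, map_mul, mul_left_comm]
  refine congrArg₂ _ ?_ rfl
  have : (E.fiberProd F).proj = F.proj ∘ (Shf.snd E F).toFun :=
    (funext (Shf.snd E F).proj_comp).symm
  rw [this]; rfl

/-- `U ×_M V`. -/
def prodSet {E F : Shf n M} (U : Set E) (V : Set F) : Set (E.fiberProd F) :=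
  (Shf.fst E F).toFun ⁻¹' U ∩ (Shf.snd E F).toFun ⁻¹' V

theorem omegaFun_extByZero {E F : Shf n M} (U : Set E) (V : Set F) (f g : M → 𝕜) :
    omegaFun (extByZero U (f ∘ E.proj)) (extByZero V (g ∘ F.proj)) =
      extByZero (prodSet U V) ((f * g) ∘ (E.fiberProd F).proj) := by
  funext p
  rw [omegaFun]
  by_cases h1 : (Shf.fst E F).toFun p ∈ U
  · by_cases h2 : (Shf.snd E F).toFun p ∈ V
    · have h3 : p ∈ prodSet U V := ⟨h1, h2⟩
      rw [extByZero_of_mem h1, extByZero_of_mem h2, extByZero_of_mem h3]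
      have e1 : (E.fiberProd F).proj = F.proj ∘ (Shf.snd E F).toFun :=
        (funext (Shf.snd E F).proj_comp).symm
      have e2 : ((f * g) ∘ (E.fiberProd F).proj) =
        ((f ∘ E.proj) ∘ (Shf.fst E F).toFun) * ((g ∘ F.proj) ∘ (Shf.snd E F).toFun) := by
        rw [Function.comp_assoc g, ← e1]; rfl
      rw [e2]; rfl
    · have h3 : p ∉ prodSet U V := fun h => h2 h.2
      rw [extByZero_of_notMem h2, map_zero, mul_zero, extByZero_of_notMem h3]
  · have h3 : p ∉ prodSet U V := fun h => h1 h.1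
    rw [extByZero_of_notMem h1, map_zero, zero_mul, extByZero_of_notMem h3]

theorem Adapted.prod {E F : Shf n M} {U : Set E} {V : Set F} {f g : Rc 𝕜 n M}
    (h : Adapted U f) (h' : Adapted V g) : Adapted (prodSet U V) (f * g) := by
  refine ⟨⟨(h.elementary.1.preimage (Shf.fst E F).smooth.continuous).inter
    (h'.elementary.1.preimage (Shf.snd E F).smooth.continuous), ?_⟩, fun x hx => ?_⟩
  · intro p hp q hq hpq
    have e1 : (Shf.fst E F).toFun p = (Shf.fst E F).toFun q :=
      h.elementary.2 hp.1 hq.1 (by rw [(Shf.fst E F).proj_comp, (Shf.fst E F).proj_comp, hpq])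
    have e2 : (Shf.snd E F).toFun p = (Shf.snd E F).toFun q :=
      h'.elementary.2 hp.2 hq.2 (by rw [(Shf.snd E F).proj_comp, (Shf.snd E F).proj_comp, hpq])
    exact Subtype.ext (Prod.ext e1 e2)
  · have h1 : x ∈ tsupport f.1 := closure_mono
      (show Function.support (f * g).1 ⊆ Function.support f.1 from
        fun y hy h0 => hy (show f y * g y = 0 by rw [show f y = 0 from h0, zero_mul])) hx
    have h2 : x ∈ tsupport g.1 := closure_mono
      (show Function.support (f * g).1 ⊆ Function.support g.1 from
        fun y hy h0 => hy (show f y * g y = 0 by rw [show g y = 0 from h0, mul_zero])) hx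
    obtain ⟨y, hy, hyx⟩ := h.supp h1
    obtain ⟨z, hz, hzx⟩ := h'.supp h2
    exact ⟨⟨(y, z), hyx.trans hzx.symm⟩, ⟨hy, hz⟩, hyx⟩

theorem omegaFun_mem {E F : Shf n M} (u : Cc 𝕜 E) (v : Cc 𝕜 F) :
    omegaFun u.1 v.1 ∈ Cc 𝕜 (E.fiberProd F) := by
  induction u using Cc.induction with
  | hz =>
    have : omegaFun (0 : Sections 𝕜 E) v.1 = 0 := by
      funext p; rw [omegaFun]; exact (congrArg (· * _) (map_zero _)).trans (zero_mul _)
    exact this ▸ zero_mem _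
  | hp U f h =>
    induction v using Cc.induction with
    | hz =>
      have : omegaFun (Cc.piece U f h).1 (0 : Sections 𝕜 F) = 0 := by
        funext p; rw [omegaFun]; exact (congrArg (_ * ·) (map_zero _)).trans (mul_zero _)
      exact this ▸ zero_mem _
    | hp V g h' =>
      have := omegaFun_extByZero (E := E) (F := F) U V f.1 g.1
      exact this ▸ (Cc.piece _ (f * g) (h.prod h')).2
    | ha v w hv hw =>
      exact (omegaFun_add_right _ v.1 w.1) ▸ add_mem hv hw
  | ha u w hu hw => exact (omegaFun_add_left u.1 w.1 v.1) ▸ add_mem hu hw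

/-- The natural map `Ω : C_c^∞(E) ⊗ C_c^∞(F) → C_c^∞(E ×_M F)`. -/
def omega (E F : Shf n M) :
    Cc 𝕜 E ⊗[Uz (Rc 𝕜 n M)] Cc 𝕜 F →ₗ[Uz (Rc 𝕜 n M)] Cc 𝕜 (E.fiberProd F) :=
  TensorProduct.lift (LinearMap.mk₂ _ (fun u v => ⟨omegaFun u.1 v.1, omegaFun_mem u v⟩)
    (fun u u' v => Subtype.ext (omegaFun_add_left _ _ _))
    (fun a u v => Uz.map_smul_of_act (C := Cc 𝕜 E) (D := Cc 𝕜 (E.fiberProd F))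
      (AddMonoidHom.mk' (fun u : Cc 𝕜 E => ⟨omegaFun u.1 v.1, omegaFun_mem u v⟩)
        fun u u' => Subtype.ext (omegaFun_add_left _ _ _))
      (fun r u => Subtype.ext (omegaFun_act_left r u.1 v.1)) a u)
    (fun u v v' => Subtype.ext (omegaFun_add_right _ _ _))
    (fun a u v => Uz.map_smul_of_act (C := Cc 𝕜 F) (D := Cc 𝕜 (E.fiberProd F))
      (AddMonoidHom.mk' (fun v : Cc 𝕜 F => ⟨omegaFun u.1 v.1, omegaFun_mem u v⟩)
        fun v v' => Subtype.ext (omegaFun_add_right _ _ _))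
      (fun r v => Subtype.ext (omegaFun_act_right r u.1 v.1)) a v))

theorem omega_tmul {E F : Shf n M} (u : Cc 𝕜 E) (v : Cc 𝕜 F) :
    (omega E F (u ⊗ₜ v)).1 = omegaFun u.1 v.1 := rfl

theorem omega_piece {E F : Shf n M} {U : Set E} {V : Set F} {f g : Rc 𝕜 n M}
    (h : Adapted U f) (h' : Adapted V g) :
    omega E F (Cc.piece U f h ⊗ₜ Cc.piece V g h') = Cc.piece _ (f * g) (h.prod h') :=
  Subtype.ext (omegaFun_extByZero U V f.1 g.1)

theorem Rc.mul_eq_of_oneAt {f η : Rc 𝕜 n M} (h : ∀ x ∈ tsupport f.1, OneAt η x) : η * f = f := by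
  refine Rc.ext fun x => ?_
  by_cases hx : x ∈ tsupport f.1
  · have : η x = 1 := (h x hx).self_of_nhds
    simp [this]
  · have : f x = 0 := image_eq_zero_of_notMem_tsupport hx
    simp [this]

theorem Adapted.exists_eta {E : Shf n M} {U : Set E} {f : Rc 𝕜 n M} (h : Adapted U f) :
    ∃ η : Rc 𝕜 n M, Adapted U η ∧ η * f = f := by
  obtain ⟨η, h1, h2⟩ := exists_one_on_compact (𝕜 := 𝕜) (n := n) f.2.2.isCompact
    (E.homeo.isOpenMap U h.elementary.1) h.supp
  exact ⟨η, ⟨h.elementary, h2⟩, Rc.mul_eq_of_oneAt h1⟩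

theorem omega_surjective (E F : Shf n M) : Function.Surjective (omega (𝕜 := 𝕜) E F) := by
  intro w
  induction w using Cc.induction with
  | hz => exact ⟨0, map_zero _⟩
  | hp W f h =>
    have h1 : Adapted ((Shf.fst E F).toFun '' W) f := h.image _
    have h2 : Adapted ((Shf.snd E F).toFun '' W) f := h.image _
    obtain ⟨η, h3, h4⟩ := h2.exists_eta
    refine ⟨Cc.piece _ f h1 ⊗ₜ Cc.piece _ η h3, ?_⟩
    rw [omega_piece]
    refine Subtype.ext ?_
    have e1 : prodSet ((Shf.fst E F).toFun '' W) ((Shf.snd E F).toFun '' W) = W := by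
      ext p
      refine ⟨?_, fun hp => ⟨⟨p, hp, rfl⟩, ⟨p, hp, rfl⟩⟩⟩
      rintro ⟨⟨q, hq, hqp⟩, ⟨q', hq', hqp'⟩⟩
      have e : q = q' := h.elementary.2 hq hq' (by
        rw [← (Shf.fst E F).proj_comp, ← (Shf.snd E F).proj_comp q', hqp, hqp',
          (Shf.fst E F).proj_comp, (Shf.snd E F).proj_comp])
      subst e
      have : p = q := Subtype.ext (Prod.ext hqp.symm hqp'.symm)
      rwa [this]
    change extByZero (prodSet _ _) _ = extByZero W _
    rw [e1, mul_comm, h4]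
  | ha u v hu hv =>
    obtain ⟨s, rfl⟩ := hu
    obtain ⟨t, rfl⟩ := hv
    exact ⟨s + t, map_add _ _ _⟩

end Pushforward

/-! ### The coalgebra of smooth functions with compact support -/

section CoalgebraOfSheaf

variable {𝕜 : Type} [RCLike 𝕜] {n : ℕ} {M : Type u} [TopologicalSpace M]
  [ChartedSpace (EuclideanSpace ℝ (Fin n)) M] [IsManifold (𝓡 n) ∞ M] [T2Space M]

section Local

variable {C : Type*} [AddCommGroup C] [Module (Uz (Rc 𝕜 n M)) C]

theorem Loc.mk_eq_of_act {x : M} {c d : C} {g : Rc 𝕜 n M} (hg : OneAt g x)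
    (h : act g c = act g d) : Loc.mk 𝕜 n x c = Loc.mk 𝕜 n x d :=
  (Submodule.Quotient.eq _).2 ⟨g, hg, by rw [act_sub, h, sub_self]⟩

/-- The functions of `R` which equal `1` near some compact set act as the identity on `c`. -/
def CompactlyUnitary (c : C) : Prop :=
  ∃ K : Set M, IsCompact K ∧ ∀ r : Rc 𝕜 n M, (∀ x ∈ K, OneAt r x) → act r c = c

theorem CompactlyUnitary.add {c d : C} (hc : CompactlyUnitary (𝕜 := 𝕜) (n := n) (M := M) c)
    (hd : CompactlyUnitary (𝕜 := 𝕜) (n := n) (M := M) d) :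
    CompactlyUnitary (𝕜 := 𝕜) (n := n) (M := M) (c + d) := by
  obtain ⟨K, hK, h1⟩ := hc
  obtain ⟨L, hL, h2⟩ := hd
  refine ⟨K ∪ L, hK.union hL, fun r hr => ?_⟩
  rw [act_add, h1 r fun x hx => hr x (Or.inl hx), h2 r fun x hx => hr x (Or.inr hx)]

theorem eq_zero_of_forall_nullAt {c : C} (h1 : CompactlyUnitary (𝕜 := 𝕜) (n := n) (M := M) c)
    (h : ∀ x : M, c ∈ nullAt 𝕜 n x C) : c = 0 := by
  obtain ⟨K, hK, hr⟩ := h1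
  obtain ⟨r, hr1, -⟩ := exists_one_on_compact (𝕜 := 𝕜) (n := n) hK isOpen_univ (Set.subset_univ _)
  obtain ⟨ψ, hψ1, hψ2⟩ : ∃ ψ : Rc 𝕜 n M, (∀ x ∈ tsupport r.1, OneAt ψ x) ∧ act ψ c = 0 := by
    refine r.2.2.isCompact.induction_on
      (p := fun K => ∃ ψ : Rc 𝕜 n M, (∀ x ∈ K, OneAt ψ x) ∧ act ψ c = 0)
      ⟨0, by simp, by rw [act, map_zero, zero_smul]⟩
      (fun s t hst h => h.imp fun r hr => ⟨fun x hx => hr.1 x (hst hx), hr.2⟩) ?_ ?_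
    · rintro s t ⟨r, hr, hr'⟩ ⟨q, hq, hq'⟩
      refine ⟨r + q - r * q, ?_, ?_⟩
      · rintro x (hx | hx)
        · filter_upwards [hr x hx] with y hy
          simp [hy]
        · filter_upwards [hq x hx] with y hy
          simp [hy]
      · have : act (r + q - r * q) c = act r c + act q c - act r (act q c) := by
          rw [← act_mul]; simp only [act, map_sub, map_add, sub_smul, add_smul]
        rw [this, hr', hq']; simp
    · intro x _
      obtain ⟨g, hg, hc⟩ := h x
      exact ⟨_, mem_nhdsWithin_of_mem_nhds (eventually_eventually_nhds.2 hg), g, fun y hy => hy, hc⟩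
  rw [← hr r hr1, ← Rc.mul_eq_of_oneAt hψ1, mul_comm, act_mul, hψ2, act_zero]

theorem Loc.mk_act_eq_zero {x : M} {r : Rc 𝕜 n M} (hr : r.1 =ᶠ[𝓝 x] 0) (c : C) :
    Loc.mk 𝕜 n x (act r c) = 0 := by
  obtain ⟨g, hg, hgr⟩ := exists_bump (𝕜 := 𝕜) (n := n) x (eventually_eventually_nhds.2 hr)
  refine (Submodule.Quotient.mk_eq_zero _).2 ⟨g, hg, ?_⟩
  have : g * r = 0 := by
    refine Rc.ext fun y => ?_
    by_cases hy : g y = 0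
    · simp [hy]
    · have h1 : r y = 0 := (hgr (subset_tsupport g.1 hy)).self_of_nhds
      simp [h1]
  rw [← act_mul, this, act, map_zero, zero_smul]

end Local

theorem Cc.compactlyUnitary {E : Shf n M} (u : Cc 𝕜 E) :
    CompactlyUnitary (𝕜 := 𝕜) (n := n) (M := M) u := by
  induction u using Cc.induction with
  | hz => exact ⟨∅, isCompact_empty, fun r _ => act_zero r⟩
  | hp U f h =>
    refine ⟨tsupport f.1, f.2.2, fun r hr => ?_⟩
    rw [Cc.act_piece]
    exact (Cc.piece_congr rfl (Rc.mul_eq_of_oneAt hr).symm h).symm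
  | ha u v hu hv => exact hu.add hv

theorem Cc.tensor_compactlyUnitary {E : Shf n M} (t : Cc 𝕜 E ⊗[Uz (Rc 𝕜 n M)] Cc 𝕜 E) :
    CompactlyUnitary (𝕜 := 𝕜) (n := n) (M := M) t := by
  induction t using TensorProduct.induction_on with
  | zero => exact ⟨∅, isCompact_empty, fun r _ => act_zero r⟩
  | tmul u v =>
    obtain ⟨K, hK, h⟩ := Cc.compactlyUnitary u
    exact ⟨K, hK, fun r hr => by rw [act_tmul, h r hr]⟩
  | add s t hs ht => exact hs.add ht

theorem Cc.locallyUnitary {E : Shf n M} (s : Finset (Cc 𝕜 E)) :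
    ∃ r : Rc 𝕜 n M, ∀ u ∈ s, act r u = u := by
  choose K hK h using fun u : Cc 𝕜 E => Cc.compactlyUnitary u
  obtain ⟨r, hr, -⟩ := exists_one_on_compact (𝕜 := 𝕜) (n := n)
    (s.isCompact_biUnion fun u _ => hK u) isOpen_univ (Set.subset_univ _)
  exact ⟨r, fun u hu => h u r fun x hx => hr x (Set.mem_biUnion (x := u) hu hx)⟩

theorem Cc.piece_shrink {E : Shf n M} {U V : Set E} {f : Rc 𝕜 n M} (h : Adapted U f)
    (h' : Adapted V f) (hVU : V ⊆ U) : Cc.piece U f h = Cc.piece V f h' := by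
  refine Subtype.ext (funext fun w => ?_)
  change extByZero U _ w = extByZero V _ w
  by_cases hV : w ∈ V
  · rw [extByZero_of_mem hV, extByZero_of_mem (hVU hV)]
  rw [extByZero_of_notMem hV]
  by_cases hU : w ∈ U
  · rw [extByZero_of_mem hU]
    have : E.proj w ∉ tsupport f.1 := fun hw => by
      obtain ⟨v, hv, hvw⟩ := h'.supp hw
      rw [h.elementary.2 (hVU hv) hU hvw] at hv
      exact hV hv
    refine (Germ.coe_eq (f := f.1 ∘ E.proj) (g := 0)).2 ?_
    exact E.homeo.continuous.continuousAt.eventually (notMem_tsupport_iff_eventuallyEq.1 this)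
  · rw [extByZero_of_notMem hU]

theorem Cc.exists_unit (E : Shf n M) (y : E) :
    ∃ (U : Set E) (b : Rc 𝕜 n M), Adapted U b ∧ y ∈ U ∧ OneAt b (E.proj y) := by
  obtain ⟨U, hU, hy, -⟩ := E.exists_elementary y univ_mem
  obtain ⟨b, hb, hbU⟩ := exists_bump (𝕜 := 𝕜) (n := n) (E.proj y)
    ((E.homeo.isOpenMap U hU.1).mem_nhds ⟨y, hy, rfl⟩)
  exact ⟨U, b, ⟨hU, hbU⟩, hy, hb⟩

theorem Cc.mk_piece_eq {E : Shf n M} {U V : Set E} {f b : Rc 𝕜 n M} (h : Adapted U f)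
    (h' : Adapted V b) {y : E} (hU : y ∈ U) (hV : y ∈ V) (hb : OneAt b (E.proj y)) :
    Loc.mk 𝕜 n (E.proj y) (Cc.piece U f h) = Loc.mk 𝕜 n (E.proj y) (act f (Cc.piece V b h')) := by
  have hUV : IsOpen (U ∩ V) := h.elementary.1.inter h'.elementary.1
  obtain ⟨g, hg, hgs⟩ := exists_bump (𝕜 := 𝕜) (n := n) (E.proj y) (inter_mem
    (eventually_eventually_nhds.2 hb) ((E.homeo.isOpenMap _ hUV).mem_nhds ⟨y, ⟨hU, hV⟩, rfl⟩))
  refine Loc.mk_eq_of_act hg ?_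
  rw [← act_mul, Cc.act_piece, Cc.act_piece]
  have e : g * f * b = g * f := by
    have : b * g = g := Rc.mul_eq_of_oneAt fun x hx => (hgs hx).1
    rw [mul_assoc, mul_comm f b, ← mul_assoc, mul_comm g b, this]
  have hs : tsupport (g * f).1 ⊆ tsupport g.1 := closure_mono
    (show Function.support (g * f).1 ⊆ Function.support g.1 from
      fun y hy h0 => hy (show g y * f y = 0 by rw [show g y = 0 from h0, zero_mul]))
  have ha : Adapted (U ∩ V) (g * f) :=
    ⟨h.elementary.mono hUV Set.inter_subset_left, hs.trans fun x hx => (hgs hx).2⟩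
  have hV' : Adapted V (g * f) := e ▸ h'.mul (g * f)
  rw [Cc.piece_congr rfl e (h'.mul (g * f)), Cc.piece_shrink (h.mul g) ha Set.inter_subset_left,
    Cc.piece_shrink hV' ha Set.inter_subset_right]

theorem Cc.mk_piece_eq_zero {E : Shf n M} {U : Set E} {f : Rc 𝕜 n M} (h : Adapted U f)
    {x : M} (hx : x ∉ E.proj '' U) : Loc.mk 𝕜 n x (Cc.piece U f h) = 0 := by
  obtain ⟨η, h1, h2⟩ := h.exists_eta
  rw [← Cc.piece_congr rfl (mul_comm η f |>.symm.trans h2) (h1.mul f), ← Cc.act_piece h1]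
  exact Loc.mk_act_eq_zero (notMem_tsupport_iff_eventuallyEq.1 fun hf => hx (h.supp hf)) _

/-- The expansion of an element of `C_c^∞(E) ⊗ C_c^∞(E)` near `x`. -/
theorem Cc.exists_expansion {E : Shf n M} (x : M)
    (e : E.proj ⁻¹' {x} → Loc 𝕜 n x (Cc 𝕜 E))
    (he : ∀ (y : E.proj ⁻¹' {x}) (U : Set E) (f : Rc 𝕜 n M) (h : Adapted U f), y.1 ∈ U →
      Loc.mk 𝕜 n x (Cc.piece U f h) = act f (e y))
    (t : Cc 𝕜 E ⊗[Uz (Rc 𝕜 n M)] Cc 𝕜 E) :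
    ∃ a : (E.proj ⁻¹' {x} × E.proj ⁻¹' {x}) →₀ Rc 𝕜 n M,
      Loc.tensor 𝕜 n x (Cc 𝕜 E) t = a.sum (fun p r => act r (e p.1 ⊗ₜ e p.2)) ∧
      ∀ p : E.fiberProd E, ∀ hp : (E.fiberProd E).proj p = x,
        (omega E E t).1 p = (((a (⟨(Shf.fst E E).toFun p, hp⟩,
          ⟨(Shf.snd E E).toFun p, ((Shf.snd E E).proj_comp p).trans hp⟩)).1 ∘
            (E.fiberProd E).proj : E.fiberProd E → 𝕜) : Germ (𝓝 p) 𝕜) := by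
  classical
  let Q : Cc 𝕜 E ⊗[Uz (Rc 𝕜 n M)] Cc 𝕜 E → Prop := fun t =>
    ∃ a : (E.proj ⁻¹' {x} × E.proj ⁻¹' {x}) →₀ Rc 𝕜 n M,
      Loc.tensor 𝕜 n x (Cc 𝕜 E) t = a.sum (fun p r => act r (e p.1 ⊗ₜ e p.2)) ∧
      ∀ p : E.fiberProd E, ∀ hp : (E.fiberProd E).proj p = x,
        (omega E E t).1 p = (((a (⟨(Shf.fst E E).toFun p, hp⟩,
          ⟨(Shf.snd E E).toFun p, ((Shf.snd E E).proj_comp p).trans hp⟩)).1 ∘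
            (E.fiberProd E).proj : E.fiberProd E → 𝕜) : Germ (𝓝 p) 𝕜)
  have hQ0 : ∀ t, Loc.tensor 𝕜 n x (Cc 𝕜 E) t = 0 →
      (∀ p : E.fiberProd E, (E.fiberProd E).proj p = x → (omega E E t).1 p = 0) → Q t :=
    fun t h1 h2 => ⟨0, by rw [h1, Finsupp.sum_zero_index], fun p hp => by rw [h2 p hp]; rfl⟩
  have hQz : Q 0 := hQ0 0 (map_zero _) fun p hp => by rw [map_zero]; rfl
  have hQa : ∀ s t, Q s → Q t → Q (s + t) := by
    rintro s t ⟨a, h1, h2⟩ ⟨b, h3, h4⟩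
    refine ⟨a + b, ?_, fun p hp => ?_⟩
    · rw [map_add, h1, h3, Finsupp.sum_add_index']
      · intro p; rw [act, map_zero, zero_smul]
      · intro p r s; rw [add_act]
    · rw [map_add]
      exact congrArg₂ (· + ·) (h2 p hp) (h4 p hp)
  have hQp : ∀ (U : Set E) (f : Rc 𝕜 n M) (h : Adapted U f) (V : Set E) (g : Rc 𝕜 n M)
      (h' : Adapted V g), Q (Cc.piece U f h ⊗ₜ Cc.piece V g h') := by
    intro U f h V g h'
    have hom : (omega E E (Cc.piece U f h ⊗ₜ Cc.piece V g h')).1 =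
      extByZero (prodSet U V) ((f * g).1 ∘ (E.fiberProd E).proj) :=
      congrArg Subtype.val (omega_piece h h')
    by_cases hU : x ∈ E.proj '' U
    swap
    · refine hQ0 _ ?_ fun p hp => ?_
      · rw [TensorProduct.map_tmul]
        exact (congrArg (fun c => c ⊗ₜ _) (Cc.mk_piece_eq_zero h hU)).trans
          (TensorProduct.zero_tmul _ _)
      · have : p ∉ prodSet U V := fun hpU => hU ⟨_, hpU.1, hp⟩
        rw [hom, extByZero_of_notMem this]
    by_cases hV : x ∈ E.proj '' V
    swap
    · refine hQ0 _ ?_ fun p hp => ?_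
      · rw [TensorProduct.map_tmul]
        exact (congrArg (fun c => _ ⊗ₜ c) (Cc.mk_piece_eq_zero h' hV)).trans
          (TensorProduct.tmul_zero _ _)
      · have : p ∉ prodSet U V := fun hpU => hV ⟨_, hpU.2, ((Shf.snd E E).proj_comp p).trans hp⟩
        rw [hom, extByZero_of_notMem this]
    obtain ⟨y, hy, hyx⟩ := hU
    obtain ⟨z, hz, hzx⟩ := hV
    refine ⟨Finsupp.single (⟨y, hyx⟩, ⟨z, hzx⟩) (f * g), ?_, fun p hp => ?_⟩
    · rw [Finsupp.sum_single_index (by rw [act, map_zero, zero_smul]), TensorProduct.map_tmul]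
      refine (congrArg₂ (fun c d => c ⊗ₜ d) (he ⟨y, hyx⟩ U f h hy) (he ⟨z, hzx⟩ V g h' hz)).trans ?_
      rw [act_mul, act_tmul', act_tmul]
    · rw [hom]
      by_cases hpU : p ∈ prodSet U V
      · have e1 : (Shf.fst E E).toFun p = y := h.elementary.2 hpU.1 hy (hp.trans hyx.symm)
        have e2 : (Shf.snd E E).toFun p = z := h'.elementary.2 hpU.2 hz
          (((Shf.snd E E).proj_comp p).trans (hp.trans hzx.symm))
        subst e1; subst e2
        rw [extByZero_of_mem hpU, Finsupp.single_eq_same]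
      · rw [extByZero_of_notMem hpU, Finsupp.single_eq_of_ne]
        · rfl
        · intro heq
          have e1 : (Shf.fst E E).toFun p = y := congrArg (fun q => q.1.1) heq
          have e2 : (Shf.snd E E).toFun p = z := congrArg (fun q => q.2.1) heq
          refine hpU ⟨?_, ?_⟩
          · change (Shf.fst E E).toFun p ∈ U
            rw [e1]; exact hy
          · change (Shf.snd E E).toFun p ∈ V
            rw [e2]; exact hz
  change Q t
  induction t using TensorProduct.induction_on with
  | zero => exact hQz
  | tmul u v =>
    induction u using Cc.induction with
    | hz => rw [TensorProduct.zero_tmul]; exact hQz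
    | hp U f h =>
      induction v using Cc.induction with
      | hz => rw [TensorProduct.tmul_zero]; exact hQz
      | hp V g h' => exact hQp U f h V g h'
      | ha v w hv hw => rw [TensorProduct.tmul_add]; exact hQa _ _ hv hw
    | ha u w hu hw => rw [TensorProduct.add_tmul]; exact hQa _ _ hu hw
  | add s t hs ht => exact hQa _ _ hs ht

theorem omega_injective (E : Shf n M) : Function.Injective (omega (𝕜 := 𝕜) E E) := by
  refine (injective_iff_map_eq_zero _).2 fun t ht => ?_
  refine eq_zero_of_forall_nullAt (Cc.tensor_compactlyUnitary t) fun x => ?_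
  rw [← Loc.tensor_eq_zero_iff]
  choose V b hb hyV hb1 using Cc.exists_unit (𝕜 := 𝕜) E
  obtain ⟨a, h1, h2⟩ := Cc.exists_expansion x
    (fun y => Loc.mk 𝕜 n x (Cc.piece (V y.1) (b y.1) (hb y.1))) (by
      rintro ⟨y, rfl⟩ U f h hy
      exact Cc.mk_piece_eq h (hb y) hy (hyV y) (hb1 y)) t
  rw [h1]
  refine Finset.sum_eq_zero fun p _ => ?_
  obtain ⟨⟨y, hy⟩, ⟨z, hz⟩⟩ := p
  have h3 := h2 ⟨(y, z), Eq.trans hy (Eq.symm hz)⟩ hy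
  rw [ht] at h3
  have h4 : ((a (⟨y, hy⟩, ⟨z, hz⟩)).1) =ᶠ[𝓝 x] 0 := by
    have h5 := (Germ.coe_eq (f := 0)).1 h3
    have h6 := (E.fiberProd E).homeo.map_nhds_eq ⟨(y, z), Eq.trans hy (Eq.symm hz)⟩
    have h7 : (E.fiberProd E).proj ⟨(y, z), Eq.trans hy (Eq.symm hz)⟩ = x := hy
    rw [h7] at h6
    rw [EventuallyEq, ← h6, eventually_map]
    exact h5.mono fun w hw => hw.symm
  refine (act_tmul _ _ _).trans ?_
  exact (congrArg (fun c => c ⊗ₜ _) (Loc.mk_act_eq_zero h4 _)).trans (TensorProduct.zero_tmul _ _)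

/-- The isomorphism `Ω : C_c^∞(E) ⊗ C_c^∞(E) → C_c^∞(E ×_M E)`. -/
def omegaEquiv (E : Shf n M) :
    Cc 𝕜 E ⊗[Uz (Rc 𝕜 n M)] Cc 𝕜 E ≃ₗ[Uz (Rc 𝕜 n M)] Cc 𝕜 (E.fiberProd E) :=
  LinearEquiv.ofBijective (omega E E) ⟨omega_injective E, omega_surjective E E⟩

/-- The comultiplication `Ω⁻¹ ∘ diag_+`. -/
def Cc.comul (E : Shf n M) : Cc 𝕜 E →ₗ[Uz (Rc 𝕜 n M)] Cc 𝕜 E ⊗[Uz (Rc 𝕜 n M)] Cc 𝕜 E :=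
  (omegaEquiv E).symm.toLinearMap ∘ₗ Cc.push E.diag

theorem Cc.comul_piece {E : Shf n M} {U : Set E} {f η : Rc 𝕜 n M} (h : Adapted U f)
    (h' : Adapted U η) (hη : η * f = f) :
    Cc.comul E (Cc.piece U f h) = Cc.piece U f h ⊗ₜ Cc.piece U η h' := by
  refine (LinearEquiv.symm_apply_eq _).2 ?_
  refine (Cc.push_piece E.diag h).trans (Eq.trans ?_ (omega_piece h h').symm)
  refine Cc.piece_congr ?_ (by rw [mul_comm, hη]) _
  ext p
  constructor
  · rintro ⟨y, hy, rfl⟩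
    exact ⟨hy, hy⟩
  · rintro ⟨h1, h2⟩
    refine ⟨_, h1, Subtype.ext (Prod.ext rfl ?_)⟩
    exact h.elementary.2 h1 h2 p.2

variable (𝕜) in
/-- The coalgebra `C_c^∞(E)`. -/
def Cc.coalg (E : Shf n M) : Coalg (Rc 𝕜 n M) where
  carrier := Cc 𝕜 E
  locallyUnitary := Cc.locallyUnitary
  comul := Cc.comul E
  counit := Cc.counit E
  id_counit u := by
    induction u using Cc.induction with
    | hz => rw [map_zero, map_zero]
    | hp U f h =>
      obtain ⟨η, h1, h2⟩ := h.exists_eta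
      rw [Cc.comul_piece h h1 h2, idTensor_tmul, Cc.counit_piece, Cc.act_piece]
      exact (Cc.piece_congr rfl h2.symm h).symm
    | ha u v hu hv => rw [map_add, map_add, hu, hv]
  counit_id u := by
    induction u using Cc.induction with
    | hz => rw [map_zero, map_zero]
    | hp U f h =>
      obtain ⟨η, h1, h2⟩ := h.exists_eta
      rw [Cc.comul_piece h h1 h2, tensorId_tmul, Cc.counit_piece, Cc.act_piece]
      exact (Cc.piece_congr rfl (by rw [mul_comm, h2]) h).symm
    | ha u v hu hv => rw [map_add, map_add, hu, hv]

theorem Cc.push_comul {E F : Shf n M} (φ : E ⟶ F) (u : Cc 𝕜 E) :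
    TensorProduct.map (Cc.push φ) (Cc.push φ) (Cc.comul E u) = Cc.comul F (Cc.push φ u) := by
  induction u using Cc.induction with
  | hz => simp
  | hp U f h =>
    obtain ⟨η, h1, h2⟩ := h.exists_eta
    rw [Cc.comul_piece h h1 h2, TensorProduct.map_tmul, Cc.push_piece, Cc.push_piece,
      Cc.comul_piece (h.image φ) (h1.image φ) h2]
  | ha u v hu hv => simp only [map_add, hu, hv]

theorem Cc.push_counit {E F : Shf n M} (φ : E ⟶ F) (u : Cc 𝕜 E) :
    Cc.counit F (Cc.push φ u) = Cc.counit E u := by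
  induction u using Cc.induction with
  | hz => simp
  | hp U f h => rw [Cc.push_piece, Cc.counit_piece, Cc.counit_piece]
  | ha u v hu hv => simp only [map_add, hu, hv]

variable (𝕜 n M) in
/-- The functor `C_c^∞` from sheaves on `M` to coalgebras over `C_c^∞(M)`. -/
def ccFunctor : Shf n M ⥤ Coalg (Rc 𝕜 n M) where
  obj E := Cc.coalg 𝕜 E
  map {E F} φ := (⟨Cc.push φ, Cc.push_comul φ, Cc.push_counit φ⟩ :
    Coalg.Hom (Cc.coalg 𝕜 E) (Cc.coalg 𝕜 F))
  map_id E := Coalg.Hom.ext' fun u => by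
    change Cc.push (𝟙 E) u = u
    induction u using Cc.induction with
    | hz => simp
    | hp U f h =>
      rw [Cc.push_piece]
      exact (Cc.piece_congr (Set.image_id U).symm rfl h).symm
    | ha u v hu hv => rw [map_add, hu, hv]
  map_comp {E F G} φ ψ := Coalg.Hom.ext' fun u => by
    change Cc.push (φ ≫ ψ) u = Cc.push ψ (Cc.push φ u)
    induction u using Cc.induction with
    | hz => simp
    | hp U f h =>
      rw [Cc.push_piece, Cc.push_piece, Cc.push_piece]
      exact Cc.piece_congr (Set.image_comp ψ.toFun φ.toFun U) rfl (h.image (φ ≫ ψ))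
    | ha u v hu hv => simp only [map_add, hu, hv]

/-- If `f` equals `1` near `x`, the class of `f ∘ π|_U` at `x` is grouplike. -/
theorem Cc.piece_grouplike {E : Shf n M} {U : Set E} {f : Rc 𝕜 n M} (h : Adapted U f) {x : M}
    (hx : OneAt f x) :
    (Cc.coalg 𝕜 E).Grouplike x (Loc.mk 𝕜 n x (C := Cc.coalg 𝕜 E) (Cc.piece U f h)) := by
  refine Coalg.WeaklyGrouplike.grouplike ?_ ?_
  · obtain ⟨η, h1, h2⟩ := h.exists_eta
    exact ⟨_, Cc.comul_piece h h1 h2⟩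
  · have : (Cc.coalg 𝕜 E).counit (Cc.piece U f h) = f := Cc.counit_piece h
    rw [this]; exact hx

/-- The point `(f ∘ π|_U)_x` of the spectral sheaf of `C_c^∞(E)`. -/
def Cc.pieceAt {E : Shf n M} (U : Set E) (f : Rc 𝕜 n M) (h : Adapted U f) (x : M)
    (hx : OneAt f x) : (spectralFunctor 𝕜 n M).obj ((ccFunctor 𝕜 n M).obj E) :=
  (⟨x, _, Cc.piece_grouplike h hx⟩ : (Cc.coalg 𝕜 E).Sp)

end CoalgebraOfSheaf

end

end SheafCoalg

/-!
Transporting the germs of `u ∈ C_c^∞(E)` at the points of the fibre `E_x` to germs at `x` gives a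
family `û` of elements of the ring `R_x` of germs at `x`, indexed by `E_x`. In these terms the
transform of `Ω(Δu)` is `û` on the diagonal of `E_x × E_x` and `0` off it, that of `Ω(u ⊗ u)` is
`û(y) û(z)`, and `ε(u)_x = ∑ û(y)`. Since `u` is recovered from `Δu` by the counit, `û = 0` forces
`u_x = 0`, so that `u_x` is determined by `û`. If `u_x` is grouplike, `û` is a family of orthogonal
idempotents with sum `1`. An idempotent germ of a continuous function is `0` or `1`, so exactly one
`û(y)` is `1`, and `u_x` is the class of `f ∘ π|_U` for every `U ∋ y` and every `f` with `f_x = 1`.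
-/

namespace SheafCoalg

noncomputable section

theorem germ_eq_zero_or_one_of_isIdempotentElem {X R : Type*} [TopologicalSpace X]
    [MonoidWithZero R] [IsLeftCancelMulZero R] [TopologicalSpace R] [T1Space R]
    {f : X → R} {x : X} (hf : ContinuousAt f x) (h : IsIdempotentElem (f : Germ (𝓝 x) R)) :
    (f : Germ (𝓝 x) R) = 0 ∨ (f : Germ (𝓝 x) R) = 1 := by
  have hval : ∀ᶠ w in 𝓝 x, f w = 0 ∨ f w = 1 :=
    (Germ.coe_eq.1 h).mono fun w hw => IsIdempotentElem.iff_eq_zero_or_one.1 hw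
  by_cases hx : f x = 0
  · refine Or.inl (Germ.coe_eq.2 ?_)
    rcases subsingleton_or_nontrivial R with _ | _
    · exact Eventually.of_forall fun w => Subsingleton.elim _ _
    · filter_upwards [hval, hf.eventually_ne (hx.trans_ne zero_ne_one)] with w hw h1
      exact hw.resolve_right h1
  · refine Or.inr (Germ.coe_eq.2 ?_)
    filter_upwards [hval, hf.eventually_ne hx] with w hw h0
    exact hw.resolve_left h0

theorem exists_eq_single_of_pairwise_mul_eq_zero {ι K : Type*} [NonAssocSemiring K] [Nontrivial K]
    [DecidableEq ι] {e : ι → K} (he : Pairwise fun i j => e i * e j = 0)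
    (h01 : ∀ i, e i = 0 ∨ e i = 1) (hsum : ∑ᶠ i, e i = 1) : ∃ i, e = Pi.single i 1 := by
  obtain ⟨i, hi⟩ : ∃ i, e i ≠ 0 := by
    by_contra! h0
    exact zero_ne_one ((finsum_eq_zero_of_forall_eq_zero h0).symm.trans hsum)
  have hi1 : e i = 1 := (h01 i).resolve_left hi
  refine ⟨i, funext fun j => ?_⟩
  obtain rfl | hj := eq_or_ne j i
  · rw [Pi.single_eq_same, hi1]
  · rw [Pi.single_eq_of_ne hj, ← mul_one (e j), ← hi1, he hj]

theorem germEquiv_symm_germEquiv {𝕜 : Type} [RCLike 𝕜] {X Y Z : Type u} [TopologicalSpace X]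
    [TopologicalSpace Y] [TopologicalSpace Z] {φ : X → Y} {p : Y → Z} {q : X → Z}
    (hφ : IsLocalHomeomorph φ) (hp : IsLocalHomeomorph p) (hq : IsLocalHomeomorph q)
    (hpq : p ∘ φ = q) {x : X} {y : Y} {z : Z} (hxy : φ x = y) (hyz : p y = z)
    (hxz : q x = z) (g : Germ (𝓝 y) 𝕜) :
    (germEquiv q hq hxz).symm (germEquiv φ hφ hxy g) = (germEquiv p hp hyz).symm g := by
  obtain ⟨k, rfl⟩ := (germEquiv p hp hyz).surjective g
  induction k using Germ.inductionOn with | _ k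
  subst hpq
  rw [RingEquiv.symm_apply_apply]
  exact germEquiv_symm_coe _ hq hxz k

theorem germEquiv_symm_symm {𝕜 : Type} [RCLike 𝕜] {X Y Z : Type u} [TopologicalSpace X]
    [TopologicalSpace Y] [TopologicalSpace Z] {φ : X → Y} {p : Y → Z} {q : X → Z}
    (hφ : IsLocalHomeomorph φ) (hp : IsLocalHomeomorph p) (hq : IsLocalHomeomorph q)
    (hpq : p ∘ φ = q) {x : X} {y : Y} {z : Z} (hxy : φ x = y) (hyz : p y = z)
    (hxz : q x = z) (g : Germ (𝓝 x) 𝕜) :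
    (germEquiv p hp hyz).symm ((germEquiv φ hφ hxy).symm g) = (germEquiv q hq hxz).symm g := by
  rw [← germEquiv_symm_germEquiv hφ hp hq hpq hxy hyz hxz, RingEquiv.apply_symm_apply]

variable {𝕜 : Type} [RCLike 𝕜] {n : ℕ} {M : Type u} [TopologicalSpace M]
  [ChartedSpace (EuclideanSpace ℝ (Fin n)) M] [IsManifold (𝓡 n) ∞ M]
  {E F : Shf n M} {x : M}

/-- The fibre `E_x` of a sheaf `π : E → M` over `x`, as a subtype of `E`. -/
abbrev Shf.Fiber (E : Shf n M) (x : M) : Type u := {y : E // E.proj y = x}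

/-- The point `(y, z)` of `(E ×_M F)_x` given by `y ∈ E_x` and `z ∈ F_x`. -/
def Shf.Fiber.pair (y : E.Fiber x) (z : F.Fiber x) : (E.fiberProd F).Fiber x :=
  ⟨⟨(y.1, z.1), Eq.trans y.2 (Eq.symm z.2)⟩, y.2⟩

theorem Shf.Fiber.exists_eq_pair (p : (E.fiberProd F).Fiber x) :
    ∃ (y : E.Fiber x) (z : F.Fiber x), p = .pair y z :=
  ⟨⟨p.1.1.1, p.2⟩, ⟨p.1.1.2, p.1.2.symm.trans p.2⟩, rfl⟩

theorem Shf.Fiber.diag_eq_pair_iff {w : E} {y z : E.Fiber x} :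
    E.diag.toFun w = (Shf.Fiber.pair y z).1 ↔ w = y.1 ∧ w = z.1 :=
  Subtype.ext_iff.trans Prod.ext_iff

/-- The family of the germs of `u ∈ C_c^∞(E)` at the points of `E_x`, each transported to a germ on
`M` at `x` along `π`. All of them then live in one ring, so germs at different points of `E_x` can
be multiplied. -/
def Cc.fiberGerm (x : M) : Cc 𝕜 E →+ (E.Fiber x → Germ (𝓝 x) 𝕜) where
  toFun u y := (germEquiv E.proj E.homeo y.2).symm (u.1 y.1)
  map_zero' := funext fun _ => map_zero _
  map_add' _ _ := funext fun _ => map_add _ _ _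

theorem Cc.fiberGerm_act (r : Rc 𝕜 n M) (u : Cc 𝕜 E) :
    Cc.fiberGerm x (act r u) = (r.1 : Germ (𝓝 x) 𝕜) • Cc.fiberGerm x u := by
  funext y
  change (germEquiv E.proj E.homeo y.2).symm ((act r u.1 : Sections 𝕜 E) y.1) = _
  rw [act_apply, map_mul, germEquiv_symm_coe]
  rfl

variable [T2Space M]

theorem Cc.fiberGerm_piece_of_mem {U : Set E} {f : Rc 𝕜 n M} (h : Adapted U f) {y : E.Fiber x}
    (hy : y.1 ∈ U) : Cc.fiberGerm x (Cc.piece U f h) y = f.1 :=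
  (congrArg _ (extByZero_of_mem hy)).trans (germEquiv_symm_coe E.proj E.homeo y.2 f.1)

theorem Cc.fiberGerm_piece_of_notMem {U : Set E} {f : Rc 𝕜 n M} (h : Adapted U f) {y : E.Fiber x}
    (hy : y.1 ∉ U) : Cc.fiberGerm x (Cc.piece U f h) y = 0 :=
  (congrArg (germEquiv E.proj E.homeo y.2).symm (extByZero_of_notMem hy)).trans (map_zero _)

theorem Cc.fiberGerm_piece [DecidableEq (E.Fiber x)] {U : Set E} {f : Rc 𝕜 n M} (h : Adapted U f)
    {y : E.Fiber x} (hy : y.1 ∈ U) : Cc.fiberGerm x (Cc.piece U f h) = Pi.single y ↑f.1 := by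
  funext z
  obtain rfl | hz := eq_or_ne z y
  · rw [Pi.single_eq_same, Cc.fiberGerm_piece_of_mem h hy]
  · rw [Pi.single_eq_of_ne hz, Cc.fiberGerm_piece_of_notMem]
    exact fun hzU => hz (Subtype.ext (h.elementary.2 hzU hy (Eq.trans z.2 (Eq.symm y.2))))

theorem Cc.exists_fiberGerm_eq_coe (u : Cc 𝕜 E) (y : E.Fiber x) :
    ∃ r : Rc 𝕜 n M, Cc.fiberGerm x u y = r.1 := by
  induction u using Cc.induction with
  | hz => exact ⟨0, congrFun (map_zero _) y⟩
  | hp U f h =>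
    by_cases hy : y.1 ∈ U
    · exact ⟨f, Cc.fiberGerm_piece_of_mem h hy⟩
    · exact ⟨0, Cc.fiberGerm_piece_of_notMem h hy⟩
  | ha u v hu hv =>
    obtain ⟨r, hr⟩ := hu
    obtain ⟨s, hs⟩ := hv
    exact ⟨r + s, by rw [map_add, Pi.add_apply, hr, hs]; rfl⟩

theorem Cc.fiberGerm_push (φ : E ⟶ F) (u : Cc 𝕜 E) (z : F.Fiber x) :
    Cc.fiberGerm x (Cc.push φ u) z =
      ∑ᶠ y : φ.toFun ⁻¹' {z.1}, Cc.fiberGerm x u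
        ⟨y.1, (φ.proj_comp y.1).symm.trans ((congrArg F.proj y.2).trans z.2)⟩ := by
  refine ((germEquiv (𝕜 := 𝕜) F.proj F.homeo z.2).symm.toAddEquiv.map_finsum _).trans ?_
  exact finsum_congr fun y =>
    germEquiv_symm_symm φ.homeo F.homeo E.homeo (funext φ.proj_comp) _ _ _ _

theorem Cc.germ_ofBase (w : Cc 𝕜 (Shf.base n M)) :
    ((Cc.ofBase w).1 : Germ (𝓝 x) 𝕜) = Cc.fiberGerm x w ⟨x, rfl⟩ := by
  induction w using Cc.induction with
  | hz => rw [map_zero, map_zero]; rfl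
  | hp U f h =>
    have hf : Cc.ofBase (Cc.piece U f h) = f := Rc.ext (Cc.value_piece h)
    rw [hf]
    by_cases hx : x ∈ U
    · exact (Cc.fiberGerm_piece_of_mem h hx).symm
    · rw [Cc.fiberGerm_piece_of_notMem h hx]
      refine Germ.coe_eq.2 (notMem_tsupport_iff_eventuallyEq.1 fun hxf => hx ?_)
      obtain ⟨_, hy, rfl⟩ := h.supp hxf
      exact hy
  | ha u v hu hv =>
    rw [map_add, map_add, Pi.add_apply, ← hu, ← hv]; rfl

theorem Cc.germ_counit (u : Cc 𝕜 E) :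
    ((Cc.counit E u).1 : Germ (𝓝 x) 𝕜) = ∑ᶠ y, Cc.fiberGerm x u y :=
  (Cc.germ_ofBase _).trans (Cc.fiberGerm_push E.projHom u ⟨x, rfl⟩)

theorem Cc.fiberGerm_push_diag [DecidableEq (E.Fiber x)] (u : Cc 𝕜 E) (y z : E.Fiber x) :
    Cc.fiberGerm x (Cc.push E.diag u) (.pair y z) = if y = z then Cc.fiberGerm x u y else 0 := by
  rw [Cc.fiberGerm_push]
  split_ifs with hyz
  · subst hyz
    rw [finsum_eq_single _ ⟨y.1, rfl⟩]
    intro w hw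
    exact absurd (Subtype.ext (Shf.Fiber.diag_eq_pair_iff.1 w.2).1) hw
  · have : IsEmpty (E.diag.toFun ⁻¹' {(Shf.Fiber.pair y z).1}) := ⟨fun w => hyz <|
      have hw := Shf.Fiber.diag_eq_pair_iff.1 w.2
      Subtype.ext (hw.1.symm.trans hw.2)⟩
    exact finsum_of_isEmpty _

theorem Cc.fiberGerm_omega_tmul (u : Cc 𝕜 E) (v : Cc 𝕜 F) (y : E.Fiber x) (z : F.Fiber x) :
    Cc.fiberGerm x (omega E F (u ⊗ₜ v)) (.pair y z) =
      Cc.fiberGerm x u y * Cc.fiberGerm x v z := by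
  refine (map_mul (germEquiv _ (E.fiberProd F).homeo _).symm _ _).trans (congrArg₂ _ ?_ ?_)
  · exact germEquiv_symm_germEquiv _ E.homeo (E.fiberProd F).homeo
      (funext (Shf.fst E F).proj_comp) _ _ _ _
  · exact germEquiv_symm_germEquiv _ F.homeo (E.fiberProd F).homeo
      (funext (Shf.snd E F).proj_comp) _ _ _ _

theorem Cc.fiberGerm_eq_zero_of_mem_nullAt {u : Cc 𝕜 E} (hu : u ∈ nullAt 𝕜 n x (Cc 𝕜 E)) :
    Cc.fiberGerm x u = 0 := by
  obtain ⟨f, hf, hfu⟩ := hu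
  have hf1 : (f.1 : Germ (𝓝 x) 𝕜) = 1 := Germ.coe_eq.2 hf
  rw [← one_smul (Germ (𝓝 x) 𝕜) (Cc.fiberGerm x u), ← hf1, ← Cc.fiberGerm_act, hfu, map_zero]

theorem Cc.tensor_eq_zero_iff (t : Cc 𝕜 E ⊗[Uz (Rc 𝕜 n M)] Cc 𝕜 E) :
    Loc.tensor 𝕜 n x (Cc 𝕜 E) t = 0 ↔ Cc.fiberGerm x (omega E E t) = 0 := by
  constructor
  · intro ht
    obtain ⟨f, hf, hft⟩ := (Loc.tensor_eq_zero_iff t).1 ht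
    refine Cc.fiberGerm_eq_zero_of_mem_nullAt ⟨f, hf, ?_⟩
    exact (map_act f t (omega E E)).symm.trans ((congrArg _ hft).trans (map_zero _))
  · intro ht
    choose V b hb hyV hb1 using Cc.exists_unit (𝕜 := 𝕜) E
    obtain ⟨a, hat, ha⟩ := Cc.exists_expansion x
      (fun y => Loc.mk 𝕜 n x (Cc.piece (V y.1) (b y.1) (hb y.1))) (by
        rintro ⟨y, rfl⟩ U f h hy
        exact Cc.mk_piece_eq h (hb y) hy (hyV y) (hb1 y)) t
    have ha0 (y z : E.Fiber x) : (a (y, z)).1 =ᶠ[𝓝 x] 0 := by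
      refine Germ.coe_eq.1 (Eq.trans (Eq.symm ?_) (congrFun ht (.pair y z)))
      exact (congrArg _ (ha (Shf.Fiber.pair y z).1 y.2)).trans (germEquiv_symm_coe _ _ _ _)
    refine hat.trans (Finset.sum_eq_zero fun p _ => (act_tmul _ _ _).trans ?_)
    exact (congrArg (fun c => c ⊗ₜ _) (Loc.mk_act_eq_zero (ha0 p.1 p.2) _)).trans
      (TensorProduct.zero_tmul _ _)

theorem Cc.fiberGerm_omega_comul [DecidableEq (E.Fiber x)] (u : Cc 𝕜 E) (y z : E.Fiber x) :
    Cc.fiberGerm x (omega E E (Cc.comul E u)) (.pair y z) =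
      if y = z then Cc.fiberGerm x u y else 0 :=
  (congrArg (fun w => Cc.fiberGerm x w (.pair y z)) ((omegaEquiv E).apply_symm_apply _)).trans
    (Cc.fiberGerm_push_diag u y z)

theorem Coalg.mk_eq_zero_of_tensor_comul_eq_zero (C : Coalg (Rc 𝕜 n M)) {c : C}
    (hc : Loc.tensor 𝕜 n x C (C.comul c) = 0) : Loc.mk 𝕜 n x c = 0 := by
  obtain ⟨f, hf, hfc⟩ := (Loc.tensor_eq_zero_iff _).1 hc
  refine (Submodule.Quotient.mk_eq_zero _).2 ⟨f, hf, ?_⟩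
  rw [← C.id_counit c, ← map_act, hfc, map_zero]

theorem Cc.mk_eq_zero_iff {u : Cc 𝕜 E} : Loc.mk 𝕜 n x u = 0 ↔ Cc.fiberGerm x u = 0 := by
  classical
  refine ⟨fun hu => Cc.fiberGerm_eq_zero_of_mem_nullAt
    ((Submodule.Quotient.mk_eq_zero _).1 hu), fun hu => ?_⟩
  have hcomul : Loc.tensor 𝕜 n x (Cc 𝕜 E) (Cc.comul E u) = 0 := by
    refine (Cc.tensor_eq_zero_iff _).2 (funext fun p => ?_)
    obtain ⟨y, z, rfl⟩ := Shf.Fiber.exists_eq_pair p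
    rw [Cc.fiberGerm_omega_comul, hu, Pi.zero_apply, Pi.zero_apply, ite_self]
  exact (Cc.coalg 𝕜 E).mk_eq_zero_of_tensor_comul_eq_zero hcomul

theorem Cc.mk_eq_mk_iff {u v : Cc 𝕜 E} :
    Loc.mk 𝕜 n x u = Loc.mk 𝕜 n x v ↔ Cc.fiberGerm x u = Cc.fiberGerm x v := by
  rw [← sub_eq_zero, ← map_sub, Cc.mk_eq_zero_iff, map_sub, sub_eq_zero]

theorem Cc.orthogonalIdempotents_fiberGerm {u : Cc 𝕜 E}
    (hu : (Cc.coalg 𝕜 E).Grouplike x (Loc.mk 𝕜 n x u)) :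
    OrthogonalIdempotents (Cc.fiberGerm x u) := by
  classical
  have htensor : Loc.tensor 𝕜 n x (Cc 𝕜 E) (Cc.comul E u - u ⊗ₜ u) = 0 := by
    rw [map_sub, TensorProduct.map_tmul, sub_eq_zero]
    exact hu.1
  rw [Cc.tensor_eq_zero_iff, map_sub, map_sub, sub_eq_zero] at htensor
  have hmul (y z : E.Fiber x) : (if y = z then Cc.fiberGerm x u y else 0) =
      Cc.fiberGerm x u y * Cc.fiberGerm x u z := by
    rw [← Cc.fiberGerm_omega_comul, htensor, Cc.fiberGerm_omega_tmul]
  exact ⟨fun y => (hmul y y).symm.trans (if_pos rfl), fun y z hyz =>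
    (hmul y z).symm.trans (if_neg hyz)⟩

theorem Cc.exists_fiberGerm_eq_single [DecidableEq (E.Fiber x)] {u : Cc 𝕜 E}
    (hu : (Cc.coalg 𝕜 E).Grouplike x (Loc.mk 𝕜 n x u)) :
    ∃ y, Cc.fiberGerm x u = Pi.single y 1 := by
  have he := Cc.orthogonalIdempotents_fiberGerm hu
  refine exists_eq_single_of_pairwise_mul_eq_zero he.ortho (fun y => ?_)
    ((Cc.germ_counit u).symm.trans hu.2)
  obtain ⟨r, hr⟩ := Cc.exists_fiberGerm_eq_coe u y
  have hidem := he.idem y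
  rw [hr] at hidem ⊢
  exact germ_eq_zero_or_one_of_isIdempotentElem r.2.1.continuous.continuousAt hidem

theorem Cc.exists_eq_pieceAt (y : E) :
    ∃ p : (spectralFunctor 𝕜 n M).obj ((ccFunctor 𝕜 n M).obj E),
      ∀ (U : Set E) (f : Rc 𝕜 n M) (h : Adapted U f) (hf : OneAt f (E.proj y)), y ∈ U →
        p = Cc.pieceAt U f h (E.proj y) hf := by
  classical
  obtain ⟨V, g, h', hyV, hg⟩ := Cc.exists_unit (𝕜 := 𝕜) E y
  refine ⟨Cc.pieceAt V g h' (E.proj y) hg, fun U f h hf hyU => ?_⟩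
  refine Coalg.Sp.ext' rfl (heq_of_eq (Cc.mk_eq_mk_iff.2 ?_))
  rw [Cc.fiberGerm_piece h' (y := ⟨y, rfl⟩) hyV, Cc.fiberGerm_piece h (y := ⟨y, rfl⟩) hyU,
    Germ.coe_eq.2 (hg.trans hf.symm)]

/-- The map `Φ_E` from a sheaf to the spectral sheaf of its coalgebra, sending `y` to the common
value of the classes `(f ∘ π|_U)_{π(y)}`. -/
def Cc.toSpectral (𝕜 : Type) [RCLike 𝕜] (E : Shf n M) (y : E) :
    (spectralFunctor 𝕜 n M).obj ((ccFunctor 𝕜 n M).obj E) :=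
  (Cc.exists_eq_pieceAt y).choose

theorem Cc.toSpectral_eq_pieceAt {U : Set E} {f : Rc 𝕜 n M} (h : Adapted U f) {y : E}
    (hf : OneAt f (E.proj y)) (hy : y ∈ U) :
    Cc.toSpectral 𝕜 E y = Cc.pieceAt U f h (E.proj y) hf :=
  (Cc.exists_eq_pieceAt y).choose_spec U f h hf hy

theorem Cc.proj_toSpectral (y : E) :
    ((spectralFunctor 𝕜 n M).obj ((ccFunctor 𝕜 n M).obj E)).proj (Cc.toSpectral 𝕜 E y) =
      E.proj y := by
  obtain ⟨U, f, h, hyU, hf⟩ := Cc.exists_unit (𝕜 := 𝕜) E y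
  exact congrArg _ (Cc.toSpectral_eq_pieceAt h hf hyU)

theorem Cc.toSpectral_eq_iff [DecidableEq (E.Fiber x)] (y : E.Fiber x) {u : Cc 𝕜 E}
    (hu : (Cc.coalg 𝕜 E).Grouplike x (Loc.mk 𝕜 n x u)) :
    Cc.toSpectral 𝕜 E y.1 = (⟨x, _, hu⟩ : (Cc.coalg 𝕜 E).Sp) ↔
      Cc.fiberGerm x u = Pi.single y 1 := by
  obtain ⟨y, rfl⟩ := y
  obtain ⟨U, f, h, hyU, hf⟩ := Cc.exists_unit (𝕜 := 𝕜) E y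
  have hf1 : (f.1 : Germ (𝓝 (E.proj y)) 𝕜) = 1 := Germ.coe_eq.2 hf
  rw [Cc.toSpectral_eq_pieceAt h hf hyU, ← hf1, ← Cc.fiberGerm_piece h hyU, ← Cc.mk_eq_mk_iff]
  exact ⟨fun heq => (eq_of_heq (Coalg.Sp.mk.inj heq).2).symm,
    fun heq => Coalg.Sp.ext' rfl (heq_of_eq heq.symm)⟩

theorem Cc.injective_toSpectral (E : Shf n M) : Function.Injective (Cc.toSpectral 𝕜 E) := by
  classical
  intro y z hyz
  obtain ⟨U, f, h, hzU, hf⟩ := Cc.exists_unit (𝕜 := 𝕜) E z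
  have hz := Cc.toSpectral_eq_pieceAt h hf hzU
  have hproj : E.proj y = E.proj z :=
    (Cc.proj_toSpectral y).symm.trans ((congrArg _ hyz).trans (Cc.proj_toSpectral z))
  have hysingle := (Cc.toSpectral_eq_iff ⟨y, hproj⟩ _).1 (hyz.trans hz)
  have hzsingle := (Cc.toSpectral_eq_iff ⟨z, rfl⟩ _).1 hz
  by_contra hne
  have hgerm := congrFun (hysingle.symm.trans hzsingle) ⟨y, hproj⟩
  rw [Pi.single_eq_same, Pi.single_eq_of_ne fun heq => hne (congrArg Subtype.val heq)] at hgerm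
  exact one_ne_zero hgerm

theorem Cc.surjective_toSpectral (E : Shf n M) : Function.Surjective (Cc.toSpectral 𝕜 E) := by
  classical
  rintro ⟨x, ζ, hζ⟩
  obtain ⟨u, rfl⟩ := Submodule.mkQ_surjective _ ζ
  obtain ⟨y, hy⟩ := Cc.exists_fiberGerm_eq_single hζ
  exact ⟨y.1, (Cc.toSpectral_eq_iff y hζ).2 hy⟩

theorem Loc.eventually_mk_eq_mk {C : Type*} [AddCommGroup C] [Module (Uz (Rc 𝕜 n M)) C] {c d : C}
    (h : Loc.mk 𝕜 n x c = Loc.mk 𝕜 n x d) : ∀ᶠ w in 𝓝 x, Loc.mk 𝕜 n w c = Loc.mk 𝕜 n w d := by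
  obtain ⟨f, hf, hfcd⟩ := (Submodule.Quotient.eq _).1 h
  filter_upwards [eventually_eventually_nhds.2 hf] with w hw
  exact (Submodule.Quotient.eq _).2 ⟨f, hw, hfcd⟩

theorem Cc.continuous_toSpectral (E : Shf n M) : Continuous (Cc.toSpectral 𝕜 E) := by
  refine continuous_iff_continuousAt.2 fun y => ?_
  obtain ⟨U, f, h, hyU, hf⟩ := Cc.exists_unit (𝕜 := 𝕜) E y
  refine (Cc.coalg 𝕜 E).isTopologicalBasis.nhds_hasBasis.tendsto_right_iff.2 ?_
  rintro _ ⟨⟨c, W, hW, -, -, rfl⟩, hy⟩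
  rw [Cc.toSpectral_eq_pieceAt h hf hyU] at hy
  obtain ⟨hyW : E.proj y ∈ W, hyc⟩ := hy
  have hnear : ∀ᶠ w in 𝓝 (E.proj y), OneAt f w ∧ w ∈ W ∧
      Loc.mk 𝕜 n w (Cc.piece U f h) = Loc.mk 𝕜 n w c :=
    (eventually_eventually_nhds.2 hf).and
      ((hW.eventually_mem hyW).and (Loc.eventually_mk_eq_mk hyc))
  filter_upwards [h.elementary.1.mem_nhds hyU,
    E.homeo.continuous.continuousAt.eventually hnear] with z hzU ⟨hfz, hzW, hzc⟩
  rw [Cc.toSpectral_eq_pieceAt h hfz hzU]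
  exact ⟨hzW, hzc⟩

/-- A bijective morphism of sheaves as an isomorphism. -/
def Shf.isoOfBijective (φ : E ⟶ F) (h : Function.Bijective φ.toFun) : E ≅ F :=
  let e : E ≃ₜ F := φ.homeo.toHomeomorphOfBijective h
  { hom := φ
    inv := Shf.homMk e.symm e.symm.continuous fun z =>
      (φ.proj_comp _).symm.trans (congrArg F.proj (e.apply_symm_apply z))
    hom_inv_id := Shf.Hom.ext' e.symm_apply_apply
    inv_hom_id := Shf.Hom.ext' e.apply_symm_apply }

/-- The isomorphism of sheaves with underlying map `Cc.toSpectral`. -/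
def Cc.spectralIso (𝕜 : Type) [RCLike 𝕜] (E : Shf n M) :
    E ≅ (spectralFunctor 𝕜 n M).obj ((ccFunctor 𝕜 n M).obj E) :=
  Shf.isoOfBijective (Shf.homMk (Cc.toSpectral 𝕜 E) (Cc.continuous_toSpectral E) Cc.proj_toSpectral)
    ⟨Cc.injective_toSpectral E, Cc.surjective_toSpectral E⟩

theorem Cc.map_pieceAt (φ : E ⟶ F) {U : Set E} {f : Rc 𝕜 n M} (h : Adapted U f)
    (hx : OneAt f x) :
    ((spectralFunctor 𝕜 n M).map ((ccFunctor 𝕜 n M).map φ)).toFun (Cc.pieceAt U f h x hx) =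
      Cc.pieceAt (φ.toFun '' U) f (h.image φ) x hx :=
  Coalg.Sp.ext' rfl (heq_of_eq (congrArg (Loc.mk 𝕜 n x) (Cc.push_piece φ h)))

theorem Cc.toSpectral_naturality (φ : E ⟶ F) (y : E) :
    Cc.toSpectral 𝕜 F (φ.toFun y) =
      ((spectralFunctor 𝕜 n M).map ((ccFunctor 𝕜 n M).map φ)).toFun (Cc.toSpectral 𝕜 E y) := by
  obtain ⟨U, f, h, hyU, hf⟩ := Cc.exists_unit (𝕜 := 𝕜) E y
  have hf' : OneAt f (F.proj (φ.toFun y)) := (φ.proj_comp y).symm ▸ hf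
  rw [Cc.toSpectral_eq_pieceAt h hf hyU, Cc.map_pieceAt,
    Cc.toSpectral_eq_pieceAt (h.image φ) hf' (Set.mem_image_of_mem _ hyU)]
  congr 1
  exact φ.proj_comp y

/-- The natural isomorphism `Φ : id → ℰ_sp ∘ C_c^∞` with components `Cc.spectralIso`. -/
def spectralNatIso (𝕜 : Type) [RCLike 𝕜] (n : ℕ) (M : Type u) [TopologicalSpace M]
    [ChartedSpace (EuclideanSpace ℝ (Fin n)) M] [IsManifold (𝓡 n) ∞ M] [T2Space M] :
    𝟭 (Shf n M) ≅ ccFunctor 𝕜 n M ⋙ spectralFunctor 𝕜 n M :=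
  NatIso.ofComponents (Cc.spectralIso 𝕜) fun φ => Shf.Hom.ext' (Cc.toSpectral_naturality φ)

end

end SheafCoalg

theorem theorem8 (𝕜 : Type) [RCLike 𝕜] (n : ℕ) (M : Type u) [TopologicalSpace M]
    [ChartedSpace (EuclideanSpace ℝ (Fin n)) M] [IsManifold (𝓡 n) ∞ M] [T2Space M] :
    ∃ Φ : 𝟭 (SheafCoalg.Shf n M) ≅
        SheafCoalg.ccFunctor 𝕜 n M ⋙ SheafCoalg.spectralFunctor 𝕜 n M,
      ∀ (E : SheafCoalg.Shf n M) (y : E),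
        (∃ (U : Set E) (f : SheafCoalg.Rc 𝕜 n M),
          SheafCoalg.Adapted U f ∧ y ∈ U ∧ SheafCoalg.OneAt f (E.proj y)) ∧
        ∀ (U : Set E) (f : SheafCoalg.Rc 𝕜 n M) (hU : SheafCoalg.Adapted U f)
          (hf : SheafCoalg.OneAt f (E.proj y)), y ∈ U →
          (Φ.hom.app E).toFun y = SheafCoalg.Cc.pieceAt U f hU (E.proj y) hf :=
  ⟨SheafCoalg.spectralNatIso 𝕜 n M, fun E y => ⟨SheafCoalg.Cc.exists_unit E y,
    fun _ _ hU hf hy => SheafCoalg.Cc.toSpectral_eq_pieceAt hU hf hy⟩⟩
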